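/- Let $K$ be a field, let $n_1<n_2<n_3<n_4$ be positive integers with $\gcd(n_1,\dots,n_4)=1$, and let $C$ be the monomial curve $x_i=t^{n_i}$ in $\mathbb A^4(K)$. Let $I(C)$ be the kernel of the $K$-algebra homomorphism $K[x_1,\dots,x_4]\to K[t]$, $x_i\mapsto t^{n_i}$. For a polynomial $f$ let $f_*$ be its homogeneous summand of least degree, and let $I(C)_*$ be the ideal generated by all $f_*$ with $f\in I(C)$. Assume that $C$ has Cohen–Macaulay tangent cone at the origin, i.e. that $K[x_1,\dots,x_4]/I(C)_*$ is Cohen–Macaulay. Assume that there are positive integers with $0<a_{12},a_{32}<a_2$, $0<a_{13},a_{43}<a_3$, $0<a_{21},a_{41}<a_1$, $0<a_{24},a_{34}<a_4$ such that $I(C)$ is minimally generated by $$f_1=x_1^{a_1}-x_2^{a_{12}}x_3^{a_{13}},\quad f_2=x_2^{a_2}-x_1^{a_{21}}x_4^{a_{24}},\quad f_3=x_3^{a_3}-x_2^{a_{32}}x_4^{a_{34}},$$ $$f_4=x_4^{a_4}-x_1^{a_{41}}x_3^{a_{43}},\quad f_5=x_1^{a_{41}}x_2^{a_{32}}-x_3^{a_{13}}x_4^{a_{24}}.$$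 Assume moreover that $a_3>a_{32}+a_{34}$ and $a_{24}\le a_{34}$. Put $$(m,\delta)=\begin{cases}\bigl(x_1^{a_{41}}x_2^{2a_{32}}x_4^{a_{34}-a_{24}},\ a_{41}+2a_{32}+a_{34}-a_{24}\bigr)&\text{if } a_{32}<a_{12},\\ \bigl(x_1^{a_1}x_2^{a_{32}-a_{12}}x_4^{a_{34}},\ a_1+a_{32}-a_{12}+a_{34}\bigr)&\text{if } a_{12}\le a_{32},\end{cases}$$ so that $\delta=\deg m$, and let $f_6=x_3^{a_3+a_{13}}-m$. Then: (A) $\{f_1,\dots,f_6\}$ is a standard basis of $I(C)$ with respect to the negative degree reverse lexicographic order with $x_4>x_3>x_2>x_1$, that is, $f_1,\dots,f_6\in I(C)$ and the leading monomial of every nonzero element of $I(C)$ is divisible by the leading monomial of some $f_i$. (Here $x^u>x^v$ if $\deg x^u<\deg x^v$, or if the degrees are equal and $u_i<v_i$ for the smallest index $i$ with $u_i\ne v_i$.) (B) $I(C)_*$ is minimally generated by the following six elements (they generate it, and none lies in the ideal generated by the other five): 1. if $a_2<a_{21}+a_{24}$ and $a_3+a_{13}<\delta$: $\ x_2^{a_{12}}x_3^{a_{13}},\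 x_2^{a_2},\ x_2^{a_{32}}x_4^{a_{34}},\ x_4^{a_4},\ x_3^{a_{13}}x_4^{a_{24}},\ x_3^{a_3+a_{13}}$; 2. if $a_2<a_{21}+a_{24}$ and $a_3+a_{13}=\delta$: $\ x_2^{a_{12}}x_3^{a_{13}},\ x_2^{a_2},\ x_2^{a_{32}}x_4^{a_{34}},\ x_4^{a_4},\ x_3^{a_{13}}x_4^{a_{24}},\ x_3^{a_3+a_{13}}-m$; 3. if $a_2=a_{21}+a_{24}$ and $a_3+a_{13}<\delta$: $\ x_2^{a_{12}}x_3^{a_{13}},\ x_2^{a_2}-x_1^{a_{21}}x_4^{a_{24}},\ x_2^{a_{32}}x_4^{a_{34}},\ x_4^{a_4},\ x_3^{a_{13}}x_4^{a_{24}},\ x_3^{a_3+a_{13}}$; 4. if $a_2=a_{21}+a_{24}$ and $a_3+a_{13}=\delta$: $\ x_2^{a_{12}}x_3^{a_{13}},\ x_2^{a_2}-x_1^{a_{21}}x_4^{a_{24}},\ x_2^{a_{32}}x_4^{a_{34}},\ x_4^{a_4},\ x_3^{a_{13}}x_4^{a_{24}},\ x_3^{a_3+a_{13}}-m$. -/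

import Mathlib

noncomputable section

namespace MonomialCurve

open MvPolynomial

/-- The data of a monomial curve in affine `4`-space, `x i = t ^ n i`, with increasing positive
exponents of greatest common divisor one. The variable `x_{i+1}` of the usual notation is `X i`. -/
structure IsCurve (n : Fin 4 → ℕ) : Prop where
  pos : ∀ i, 0 < n i
  strictMono : StrictMono n
  gcd_eq_one : Finset.univ.gcd n = 1

/-- The toric ideal `I(C)`: the kernel of `x i ↦ t ^ n i`. -/
def toricIdeal (K : Type*) [Field K] (n : Fin 4 → ℕ) : Ideal (MvPolynomial (Fin 4) K) :=
  RingHom.ker (aeval (fun i => (Polynomial.X : Polynomial K) ^ n i) :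
    MvPolynomial (Fin 4) K →ₐ[K] Polynomial K)

/-- The homogeneous summand of least degree of `f` (it is `0` for `f = 0`). -/
def leastForm {K : Type*} [Field K] (f : MvPolynomial (Fin 4) K) : MvPolynomial (Fin 4) K :=
  homogeneousComponent (sInf {d : ℕ | homogeneousComponent d f ≠ 0}) f

/-- The ideal `I_*` generated by the least homogeneous summands of the elements of `I`. -/
def tangentIdeal {K : Type*} [Field K] (I : Ideal (MvPolynomial (Fin 4) K)) :
    Ideal (MvPolynomial (Fin 4) K) :=
  Ideal.span {g | ∃ f ∈ I, g = leastForm f}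

/-- A Noetherian local ring is Cohen-Macaulay if some regular sequence
has length the dimension of the ring. -/
def IsCohenMacaulayLocal (R : Type*) [CommRing R] : Prop :=
  IsLocalRing R ∧ IsNoetherianRing R ∧
    ∃ rs : List R, RingTheory.Sequence.IsRegular R rs ∧
      ((rs.length : ℕ) : WithBot ℕ∞) = ringKrullDim R

/-- A Noetherian ring is Cohen-Macaulay if its localizations at maximal ideals are. -/
def IsCohenMacaulay (R : Type*) [CommRing R] : Prop :=
  IsNoetherianRing R ∧
    ∀ (m : Ideal R) [m.IsMaximal], IsCohenMacaulayLocal (Localization.AtPrime m)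

/-- The curve has Cohen-Macaulay tangent cone at the origin: the coordinate ring
`K[x_1, …, x_4] / I(C)_*` of the tangent cone is Cohen-Macaulay. -/
def HasCMTangentCone (K : Type*) [Field K] (n : Fin 4 → ℕ) : Prop :=
  IsCohenMacaulay (MvPolynomial (Fin 4) K ⧸ tangentIdeal (toricIdeal K n))

/-- `I` is minimally generated by the listed elements `g 0, g 1, …`: they generate `I`, and none
of them lies in the ideal generated by the others (so in particular they are distinct). -/
def MinimallyGenerated {K : Type*} [Field K] {r : ℕ} (I : Ideal (MvPolynomial (Fin 4) K))
    (g : Fin r → MvPolynomial (Fin 4) K) : Prop :=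
  Ideal.span (Set.range g) = I ∧ ∀ i, g i ∉ Ideal.span (g '' {i}ᶜ)

/-- The negative degree reverse lexicographic order with `x_4 > x_3 > x_2 > x_1`:
`DsGT u v` says that the monomial `x ^ u` is larger than `x ^ v`. Smaller total degree is larger;
for equal degrees, the monomial in which the first differing variable, starting from `x_1`,
has the smaller exponent is larger. -/
def DsGT (u v : Fin 4 →₀ ℕ) : Prop :=
  u.degree < v.degree ∨
    (u.degree = v.degree ∧ ∃ i, (∀ j < i, u j = v j) ∧ u i < v i)

/-- `x ^ u` is the leading monomial of `f` for the order `DsGT`. -/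
def IsLeadingMonomial {K : Type*} [Field K] (f : MvPolynomial (Fin 4) K) (u : Fin 4 →₀ ℕ) : Prop :=
  u ∈ f.support ∧ ∀ v ∈ f.support, v ≠ u → DsGT u v

/-- `G` is a standard basis of `I` for the order `DsGT`: a finite subset of `I` such that
the leading monomial of each nonzero `f ∈ I` is divisible by the leading monomial of a nonzero
element of `G`. -/
def IsStandardBasis {K : Type*} [Field K] (G : Set (MvPolynomial (Fin 4) K))
    (I : Ideal (MvPolynomial (Fin 4) K)) : Prop :=
  G.Finite ∧ G ⊆ (I : Set (MvPolynomial (Fin 4) K)) ∧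
    ∀ f ∈ I, f ≠ 0 →
      ∃ g ∈ G, ∃ u v, IsLeadingMonomial g u ∧ IsLeadingMonomial f v ∧ u ≤ v

/-- The exponents occurring in the five generators of case 2(b). -/
structure Exponents where
  a1 : ℕ
  a2 : ℕ
  a3 : ℕ
  a4 : ℕ
  a12 : ℕ
  a13 : ℕ
  a21 : ℕ
  a24 : ℕ
  a32 : ℕ
  a34 : ℕ
  a41 : ℕ
  a43 : ℕ

variable (K : Type*) [Field K] (e : Exponents)

/-- `f_1 = x_1^{a_1} - x_2^{a_12} x_3^{a_13}` -/
def f1 : MvPolynomial (Fin 4) K := X 0 ^ e.a1 - X 1 ^ e.a12 * X 2 ^ e.a13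

/-- `f_2 = x_2^{a_2} - x_1^{a_21} x_4^{a_24}` -/
def f2 : MvPolynomial (Fin 4) K := X 1 ^ e.a2 - X 0 ^ e.a21 * X 3 ^ e.a24

/-- `f_3 = x_3^{a_3} - x_2^{a_32} x_4^{a_34}` -/
def f3 : MvPolynomial (Fin 4) K := X 2 ^ e.a3 - X 1 ^ e.a32 * X 3 ^ e.a34

/-- `f_4 = x_4^{a_4} - x_1^{a_41} x_3^{a_43}` -/
def f4 : MvPolynomial (Fin 4) K := X 3 ^ e.a4 - X 0 ^ e.a41 * X 2 ^ e.a43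

/-- `f_5 = x_1^{a_41} x_2^{a_32} - x_3^{a_13} x_4^{a_24}` -/
def f5 : MvPolynomial (Fin 4) K :=
  X 0 ^ e.a41 * X 1 ^ e.a32 - X 2 ^ e.a13 * X 3 ^ e.a24

/-- `I(C)` is given as in case 2(b): it is minimally generated by `f_1, …, f_5`, where
`0 < a_ij < a_j` for all the mixed exponents. -/
structure GivenAsCase2b (n : Fin 4 → ℕ) : Prop where
  a12_mem : 0 < e.a12 ∧ e.a12 < e.a2
  a13_mem : 0 < e.a13 ∧ e.a13 < e.a3
  a21_mem : 0 < e.a21 ∧ e.a21 < e.a1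
  a24_mem : 0 < e.a24 ∧ e.a24 < e.a4
  a32_mem : 0 < e.a32 ∧ e.a32 < e.a2
  a34_mem : 0 < e.a34 ∧ e.a34 < e.a4
  a41_mem : 0 < e.a41 ∧ e.a41 < e.a1
  a43_mem : 0 < e.a43 ∧ e.a43 < e.a3
  generated : MinimallyGenerated (toricIdeal K n) ![f1 K e, f2 K e, f3 K e, f4 K e, f5 K e]

/-- `f_6 = x_3^{a_3+a_13} - x_1^{a_41} x_2^{2 a_32} x_4^{a_34-a_24}`, used for `a_24 ≤ a_34`. -/
def f6 : MvPolynomial (Fin 4) K :=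
  X 2 ^ (e.a3 + e.a13) - X 0 ^ e.a41 * X 1 ^ (2 * e.a32) * X 3 ^ (e.a34 - e.a24)

/-- `f_6 = x_3^{a_3+a_13} - x_1^{a_1} x_2^{a_32-a_12} x_4^{a_34}`, used for `a_12 ≤ a_32`. -/
def f6Alt : MvPolynomial (Fin 4) K :=
  X 2 ^ (e.a3 + e.a13) - X 0 ^ e.a1 * X 1 ^ (e.a32 - e.a12) * X 3 ^ e.a34

end MonomialCurve

end

noncomputable section

namespace MonomialCurve

open MvPolynomial Relation

/-! Everything is reduced to rewriting exponent vectors. `I(C)` is spanned by differences of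
monomials of equal weight, and each binomial `f_i` becomes a rule replacing its leading monomial by
the other one. Rules preserve weight and move down in the local order; since a weight class is
finite, rewriting terminates even though degrees may grow.

The six rules are locally confluent (`join_of_overlap`): `f_6` is what the monomial `x_2^{a_32}
x_3^{a_13} x_4^{a_34}` forces, reduced by `f_3` on one side and by `f_5` or `f_1` on the other. By
Newman's lemma joinability is an equivalence relation, and since `f_1, …, f_5` generate `I(C)`, any
two exponents of equal weight are joinable (`join_of_weight_eq`). Both conclusions follow from this:
a leading monomial cannot be irreducible (`isStandardBasis_range`), and least forms can be followed
along rewriting chains (`span_binomialLeastForm`).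

The Cohen–Macaulay hypothesis serves only to orient `f_2` and `f_6`. It makes `x_1` a nonzerodivisor
modulo `I(C)_*` (`mem_of_X_zero_mul_mem`). If the side of `f_2` or `f_6` involving `x_1` had smaller
degree, its cofactor free of `x_1` would lie in `I(C)_*`. But `I(C)_*` lies in the ideal generated
by all monomials occurring in `f_1, …, f_5`, and none of them divides that cofactor. -/

/-- The weight `∑ n_i u_i` of an exponent vector: `x ^ u` is sent to `t ^ weight n u`. -/
def weight (n : Fin 4 → ℕ) (u : Fin 4 →₀ ℕ) : ℕ := ∑ i, n i * u i

lemma weight_add (n : Fin 4 → ℕ) (u v : Fin 4 →₀ ℕ) :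
    weight n (u + v) = weight n u + weight n v := by
  simp [weight, mul_add, Finset.sum_add_distrib]

lemma degree_le_weight {n : Fin 4 → ℕ} (hn : ∀ i, 0 < n i) (u : Fin 4 →₀ ℕ) :
    u.degree ≤ weight n u := by
  rw [Finsupp.degree_eq_sum]
  exact Finset.sum_le_sum fun i _ => Nat.le_mul_of_pos_left _ (hn i)

lemma finite_setOf_weight_eq {n : Fin 4 → ℕ} (hn : ∀ i, 0 < n i) (w : ℕ) :
    {u : Fin 4 →₀ ℕ | weight n u = w}.Finite := by
  refine (Set.finite_Iic (Finsupp.equivFunOnFinite.symm fun _ : Fin 4 => w)).subset fun u hu i => ?_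
  have h1 := degree_le_weight hn u
  have h2 : u i ≤ u.degree := Finsupp.le_degree i u
  rw [Set.mem_ofPred_eq] at hu
  simpa using by omega

/-! ### Toric ideal and least forms of binomials. -/

section Toric

variable {K : Type*} [Field K] {n : Fin 4 → ℕ}

lemma aeval_monomial_eq (n : Fin 4 → ℕ) (u : Fin 4 →₀ ℕ) (c : K) :
    aeval (fun i => (Polynomial.X : Polynomial K) ^ n i) (monomial u c) =
      Polynomial.monomial (weight n u) c := by
  rw [aeval_monomial, Finsupp.prod_fintype _ _ (by simp), ← Polynomial.C_mul_X_pow_eq_monomial]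
  simp [weight, ← pow_mul, Finset.prod_pow_eq_pow_sum]

lemma mem_toricIdeal_iff {f : MvPolynomial (Fin 4) K} :
    f ∈ toricIdeal K n ↔ ∀ w, ∑ u ∈ f.support with weight n u = w, coeff u f = 0 := by
  have h : aeval (fun i => (Polynomial.X : Polynomial K) ^ n i) f =
      ∑ u ∈ f.support, Polynomial.monomial (weight n u) (coeff u f) := by
    conv_lhs => rw [f.as_sum, map_sum]
    exact Finset.sum_congr rfl fun u _ => aeval_monomial_eq n u _
  rw [toricIdeal, RingHom.mem_ker, h, Polynomial.ext_iff]
  refine forall_congr' fun w => ?_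
  rw [Polynomial.finsetSum_coeff, Finset.sum_filter]
  simp [Polynomial.coeff_monomial]

lemma monomial_sub_mem_toricIdeal_iff {u v : Fin 4 →₀ ℕ} :
    monomial u 1 - monomial v 1 ∈ toricIdeal K n ↔ weight n u = weight n v := by
  rw [toricIdeal, RingHom.mem_ker, map_sub, aeval_monomial_eq, aeval_monomial_eq, sub_eq_zero]
  refine ⟨fun h => ?_, fun h => by rw [h]⟩
  by_contra hne
  have := congrArg (fun p => Polynomial.coeff p (weight n u)) h
  simp [Polynomial.coeff_monomial, Ne.symm hne] at this

lemma exists_leastForm_eq (f : MvPolynomial (Fin 4) K) :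
    ∃ d, leastForm f = homogeneousComponent d f ∧ ∀ u ∈ f.support, d ≤ u.degree := by
  refine ⟨_, rfl, fun u hu => Nat.sInf_le fun h => ?_⟩
  have := congrArg (coeff u) h
  rw [coeff_homogeneousComponent, if_pos rfl, coeff_zero] at this
  exact mem_support_iff.1 hu this

lemma leastForm_eq {f : MvPolynomial (Fin 4) K} {p : Fin 4 →₀ ℕ} (hp : p ∈ f.support)
    (h : ∀ u ∈ f.support, p.degree ≤ u.degree) :
    leastForm f = homogeneousComponent p.degree f := by
  have h1 : p.degree ∈ {d : ℕ | homogeneousComponent d f ≠ 0} := fun h => by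
    have := congrArg (coeff p) h
    rw [coeff_homogeneousComponent, if_pos rfl, coeff_zero] at this
    exact mem_support_iff.1 hp this
  have h2 : sInf {d : ℕ | homogeneousComponent d f ≠ 0} = p.degree := by
    refine le_antisymm (Nat.sInf_le h1) (le_csInf ⟨_, h1⟩ fun d hd => ?_)
    by_contra hlt
    refine hd (homogeneousComponent_eq_zero' _ _ fun u hu => ?_)
    have := h u hu
    omega
  rw [leastForm, h2]

lemma mem_support_monomial_sub {u p q : Fin 4 →₀ ℕ}
    (hu : u ∈ (monomial p 1 - monomial q 1 : MvPolynomial (Fin 4) K).support) : u = p ∨ u = q := by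
  rw [mem_support_iff, coeff_sub, coeff_monomial, coeff_monomial] at hu
  by_contra! h
  simp [h.1.symm, h.2.symm] at hu

lemma leastForm_monomial_sub_of_lt {p q : Fin 4 →₀ ℕ} (h : p.degree < q.degree) :
    leastForm (monomial p 1 - monomial q 1 : MvPolynomial (Fin 4) K) = monomial p 1 := by
  have hne : q ≠ p := by rintro rfl; exact lt_irrefl _ h
  rw [leastForm_eq (p := p)]
  · rw [map_sub, homogeneousComponent_of_mem (isHomogeneous_monomial 1 rfl),
      homogeneousComponent_of_mem (isHomogeneous_monomial 1 rfl), if_pos rfl, if_neg h.ne, sub_zero]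
  · rw [mem_support_iff]
    simp [coeff_monomial, hne]
  · intro u hu
    rcases mem_support_monomial_sub hu with rfl | rfl
    exacts [le_rfl, h.le]

lemma leastForm_monomial_sub_of_eq {p q : Fin 4 →₀ ℕ} (h : p.degree = q.degree) :
    leastForm (monomial p 1 - monomial q 1 : MvPolynomial (Fin 4) K) =
      monomial p 1 - monomial q 1 := by
  rcases eq_or_ne p q with rfl | hne
  · simp [leastForm]
  rw [leastForm_eq (p := p)]
  · rw [map_sub, homogeneousComponent_of_mem (isHomogeneous_monomial 1 rfl),
      homogeneousComponent_of_mem (isHomogeneous_monomial 1 rfl), if_pos rfl, if_pos h]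
  · rw [mem_support_iff]
    simp [coeff_monomial, hne.symm]
  · intro u hu
    rcases mem_support_monomial_sub hu with rfl | rfl
    exacts [le_rfl, h.le]

lemma leastForm_mem_tangentIdeal {I : Ideal (MvPolynomial (Fin 4) K)} {f : MvPolynomial (Fin 4) K}
    (hf : f ∈ I) : leastForm f ∈ tangentIdeal I :=
  Ideal.subset_span ⟨f, hf, rfl⟩

lemma monomial_mem_tangentIdeal {p q : Fin 4 →₀ ℕ} (hw : weight n p = weight n q)
    (h : p.degree < q.degree) : monomial p 1 ∈ tangentIdeal (toricIdeal K n) := by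
  rw [← leastForm_monomial_sub_of_lt h]
  exact leastForm_mem_tangentIdeal (monomial_sub_mem_toricIdeal_iff.2 hw)

lemma monomial_sub_mem_tangentIdeal {p q : Fin 4 →₀ ℕ} (hw : weight n p = weight n q)
    (h : p.degree = q.degree) : monomial p 1 - monomial q 1 ∈ tangentIdeal (toricIdeal K n) := by
  rw [← leastForm_monomial_sub_of_eq h]
  exact leastForm_mem_tangentIdeal (monomial_sub_mem_toricIdeal_iff.2 hw)

/-- A monomial ideal containing `I` contains `I_*`. -/
lemma tangentIdeal_le_of_le {I : Ideal (MvPolynomial (Fin 4) K)} {s : Set (Fin 4 →₀ ℕ)}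
    (h : I ≤ Ideal.span ((fun u => monomial u (1 : K)) '' s)) :
    tangentIdeal I ≤ Ideal.span ((fun u => monomial u (1 : K)) '' s) := by
  refine Ideal.span_le.2 ?_
  rintro _ ⟨f, hf, rfl⟩
  refine mem_ideal_span_monomial_image.2 fun u hu => mem_ideal_span_monomial_image.1 (h hf) u ?_
  obtain ⟨d, hd, -⟩ := exists_leastForm_eq f
  rw [mem_support_iff, hd, coeff_homogeneousComponent] at hu
  rw [mem_support_iff]
  intro h0
  simp [h0] at hu

end Toric

/-! ### Rewriting of exponent vectors: termination and joinability. -/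

/-- Newman's lemma: a terminating locally confluent relation is confluent. -/
lemma join_of_locally_confluent {α : Type*} {r : α → α → Prop} (hwf : WellFounded (Function.swap r))
    (hloc : ∀ a b c, r a b → r a c → Join (ReflTransGen r) b c) (a b c : α)
    (hab : ReflTransGen r a b) (hac : ReflTransGen r a c) : Join (ReflTransGen r) b c := by
  induction a using hwf.induction generalizing b c with
  | _ a ih =>
    rcases hab.cases_head with rfl | ⟨b', hb', hb⟩
    · exact ⟨c, hac, .refl⟩
    rcases hac.cases_head with rfl | ⟨c', hc', hc⟩
    · exact ⟨b, .refl, hab⟩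
    obtain ⟨d, hbd, hcd⟩ := hloc a b' c' hb' hc'
    obtain ⟨x, hbx, hdx⟩ := ih b' hb' b d hb hbd
    obtain ⟨y, hcy, hxy⟩ := ih c' hc' c x hc (hcd.trans hdx)
    exact ⟨y, hbx.trans hxy, hcy⟩

/-- The sort key of `DsGT`: total degree first, then the exponents lexicographically. -/
def sortKey (u : Fin 4 →₀ ℕ) : ℕ ×ₗ Lex (Fin 4 → ℕ) := toLex (u.degree, toLex ⇑u)

lemma sortKey_injective : Function.Injective sortKey := fun u v h => by
  have h1 := congrArg (fun x => ofLex (ofLex x).2) h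
  exact DFunLike.coe_injective h1

lemma sortKey_lt_iff {u v : Fin 4 →₀ ℕ} : sortKey u < sortKey v ↔ DsGT u v := by
  rw [sortKey, sortKey, Prod.Lex.toLex_lt_toLex]
  rfl

lemma degree_le_of_sortKey_le {u v : Fin 4 →₀ ℕ} (h : sortKey u ≤ sortKey v) :
    u.degree ≤ v.degree := by
  rcases Prod.Lex.toLex_le_toLex.1 h with h | h
  exacts [h.le, h.1.le]

lemma exists_isLeadingMonomial {K : Type*} [Field K] {f : MvPolynomial (Fin 4) K} (hf : f ≠ 0) :
    ∃ v, IsLeadingMonomial f v := by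
  obtain ⟨v, hv, h⟩ := f.support.exists_min_image sortKey (support_nonempty.2 hf)
  exact ⟨v, hv, fun u hu hne => sortKey_lt_iff.1
    ((h u hu).lt_of_ne fun h => hne (sortKey_injective h).symm)⟩

/-- The rules `x ^ p i → x ^ q i` rewrite `x ^ u` to `x ^ v` in one step. -/
def Step {ι : Type*} (p q : ι → Fin 4 →₀ ℕ) (u v : Fin 4 →₀ ℕ) : Prop :=
  ∃ i s, u = p i + s ∧ v = q i + s

section Rewriting

variable {K : Type*} [Field K] {n : Fin 4 → ℕ} {ι : Type*} {p q : ι → Fin 4 →₀ ℕ}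

lemma Step.add_right {u v : Fin 4 →₀ ℕ} (h : Step p q u v) (s : Fin 4 →₀ ℕ) :
    Step p q (u + s) (v + s) := by
  obtain ⟨i, t, rfl, rfl⟩ := h
  exact ⟨i, t + s, add_assoc _ _ _, add_assoc _ _ _⟩

lemma join_add_right {u v : Fin 4 →₀ ℕ} (h : Join (ReflTransGen (Step p q)) u v)
    (s : Fin 4 →₀ ℕ) : Join (ReflTransGen (Step p q)) (u + s) (v + s) := by
  obtain ⟨w, hu, hv⟩ := h
  exact ⟨w + s, hu.lift (· + s) fun _ _ h => h.add_right s,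
    hv.lift (· + s) fun _ _ h => h.add_right s⟩

lemma Step.weight_eq (hw : ∀ i, weight n (p i) = weight n (q i)) {u v : Fin 4 →₀ ℕ}
    (h : Step p q u v) : weight n u = weight n v := by
  obtain ⟨i, t, rfl, rfl⟩ := h
  rw [weight_add, weight_add, hw]

lemma Step.sortKey_lt (hd : ∀ i, DsGT (p i) (q i)) {u v : Fin 4 →₀ ℕ}
    (h : Step p q u v) : sortKey u < sortKey v := by
  obtain ⟨i, t, rfl, rfl⟩ := h
  rw [sortKey_lt_iff]
  rcases hd i with h | ⟨h, j, hj, hlt⟩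
  · left
    simpa using h
  · right
    refine ⟨by simpa using h, j, fun k hk => by simp [hj k hk], by simpa using hlt⟩

lemma sortKey_le_of_reflTransGen (hd : ∀ i, DsGT (p i) (q i)) {u v : Fin 4 →₀ ℕ}
    (h : ReflTransGen (Step p q) u v) : sortKey u ≤ sortKey v := by
  induction h with
  | refl => exact le_rfl
  | tail _ h ih => exact ih.trans (h.sortKey_lt hd).le

/-- The local order is not a well-order in the direction of rewriting. Termination comes from
positivity of the weights: the number of exponents of the same weight lying further along the order
is finite and drops at each step. -/
lemma wellFounded_swap_step (hn : ∀ i, 0 < n i) (hw : ∀ i, weight n (p i) = weight n (q i))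
    (hd : ∀ i, DsGT (p i) (q i)) : WellFounded (Function.swap (Step p q)) := by
  refine Subrelation.wf (r := InvImage (· < ·) fun u =>
    {v | weight n v = weight n u ∧ sortKey u < sortKey v}.ncard) ?_ (InvImage.wf _ wellFounded_lt)
  intro v u (h : Step p q u v)
  have h1 := h.weight_eq hw
  have h2 := h.sortKey_lt hd
  refine Set.ncard_lt_ncard ⟨fun x hx => ⟨hx.1.trans h1.symm, h2.trans hx.2⟩, fun hsub => ?_⟩
    ((finite_setOf_weight_eq hn (weight n u)).subset fun x hx => hx.1)
  exact lt_irrefl _ (hsub (show v ∈ _ from ⟨h1.symm, h2⟩)).2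

/-- If joinability is an equivalence relation identifying the two monomials of each binomial
`x ^ a i - x ^ b i`, and these binomials generate an ideal containing `x ^ u - x ^ v`, then
`u` and `v` are joinable. -/
lemma join_of_monomial_sub_mem_span {κ : Type*} [Fintype κ] {a b : κ → Fin 4 →₀ ℕ}
    (heq : Equivalence (Join (ReflTransGen (Step p q))))
    (hab : ∀ i, Join (ReflTransGen (Step p q)) (a i) (b i)) {u v : Fin 4 →₀ ℕ}
    (h : (monomial u 1 - monomial v 1 : MvPolynomial (Fin 4) K) ∈
      Ideal.span (Set.range fun i => monomial (a i) 1 - monomial (b i) 1)) :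
    Join (ReflTransGen (Step p q)) u v := by
  let S : Setoid (Fin 4 →₀ ℕ) := ⟨_, heq⟩
  -- Sending each monomial to its joinability class, as a basis vector of a free space, kills every
  -- multiple of the generators, hence the ideal they span. Distinct classes stay independent.
  let Φ : MvPolynomial (Fin 4) K →ₗ[K] (Quotient S →₀ K) :=
    (basisMonomials (Fin 4) K).constr K fun u => Finsupp.single (Quotient.mk S u) 1
  have hΦ : ∀ u c, Φ (monomial u c) = Finsupp.single (Quotient.mk S u) c := fun u c => by
    have h1 : Φ (monomial u 1) = Finsupp.single (Quotient.mk S u) 1 := by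
      have := (basisMonomials (Fin 4) K).constr_basis K
        (fun u => Finsupp.single (Quotient.mk S u) (1 : K)) u
      rwa [coe_basisMonomials] at this
    rw [← mul_one c, ← smul_eq_mul, ← smul_monomial, map_smul, h1, Finsupp.smul_single]
  have hker : ∀ (g : MvPolynomial (Fin 4) K) i,
      Φ (g * (monomial (a i) 1 - monomial (b i) 1)) = 0 := fun g i => by
    induction g using MvPolynomial.induction_on' with
    | monomial s c =>
      have hs : Quotient.mk S (s + a i) = Quotient.mk S (s + b i) := Quotient.sound <| by
        rw [add_comm s, add_comm s]
        exact join_add_right (hab i) s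
      rw [mul_sub, monomial_mul, monomial_mul, map_sub, hΦ, hΦ, hs, sub_self]
    | add f g hf hg => rw [add_mul, map_add, hf, hg, add_zero]
  obtain ⟨c, hc⟩ := Ideal.mem_span_range_iff_exists_fun.1 h
  have h0 : Φ (monomial u 1 - monomial v 1) = 0 := by
    rw [← hc, map_sum]
    exact Finset.sum_eq_zero fun i _ => hker _ i
  rw [map_sub, hΦ, hΦ, sub_eq_zero, Finsupp.single_left_inj one_ne_zero] at h0
  exact Quotient.exact h0

end Rewriting

/-! ### Standard bases and tangent ideals from joinability. -/

section Rewriting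

variable {K : Type*} [Field K] {n : Fin 4 → ℕ} {ι : Type*} {p q : ι → Fin 4 →₀ ℕ}

lemma isLeadingMonomial_monomial_sub {u v : Fin 4 →₀ ℕ} (h : DsGT u v) :
    IsLeadingMonomial (monomial u 1 - monomial v 1 : MvPolynomial (Fin 4) K) u := by
  have hne : v ≠ u := by
    rintro rfl
    exact lt_irrefl _ (sortKey_lt_iff.2 h)
  refine ⟨?_, fun w hw hwu => ?_⟩
  · rw [mem_support_iff]
    simp [coeff_monomial, hne]
  · rcases mem_support_monomial_sub hw with rfl | rfl
    exacts [absurd rfl hwu, h]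

lemma IsLeadingMonomial.neg {f : MvPolynomial (Fin 4) K} {u : Fin 4 →₀ ℕ}
    (h : IsLeadingMonomial f u) : IsLeadingMonomial (-f) u := by
  rwa [IsLeadingMonomial, support_neg]

/-- Rules that increase the sort key and join any two exponents of equal weight give a
standard basis. -/
lemma isStandardBasis_range [Finite ι] (hd : ∀ i, DsGT (p i) (q i))
    (hjoin : ∀ u v, weight n u = weight n v → Join (ReflTransGen (Step p q)) u v)
    {g : ι → MvPolynomial (Fin 4) K} (hg : ∀ i, g i ∈ toricIdeal K n)
    (hlead : ∀ i, IsLeadingMonomial (g i) (p i)) :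
    IsStandardBasis (Set.range g) (toricIdeal K n) := by
  refine ⟨Set.finite_range _, Set.range_subset_iff.2 hg, fun f hf hf0 => ?_⟩
  obtain ⟨v, hv⟩ := exists_isLeadingMonomial hf0
  -- The coefficients of `f` in one weight sum to zero, so the leading term has a partner of the
  -- same weight.
  obtain ⟨u, hu, huw, huv⟩ : ∃ u ∈ f.support, weight n u = weight n v ∧ u ≠ v := by
    by_contra! h
    refine mem_support_iff.1 hv.1 ?_
    rw [← mem_toricIdeal_iff.1 hf (weight n v), Finset.sum_eq_single_of_mem v]
    · simpa using mem_support_iff.1 hv.1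
    · intro u hu hne
      rw [Finset.mem_filter] at hu
      exact absurd (h u hu.1 hu.2) hne
  obtain ⟨w, hvw, huw'⟩ := hjoin v u huw.symm
  -- If `v` were irreducible, then `u` would rewrite to `v`, so `v` would not be leading.
  rcases hvw.cases_head with rfl | ⟨w', ⟨i, s, rfl, -⟩, -⟩
  · exact absurd (sortKey_lt_iff.2 (hv.2 u hu huv)) (sortKey_le_of_reflTransGen hd huw').not_gt
  · exact ⟨_, ⟨i, rfl⟩, _, _, hlead i, hv, le_self_add⟩

/-- The least form of `x ^ u - x ^ v` when `u.degree ≤ v.degree`. -/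
def binomialLeastForm (K : Type*) [Field K] (u v : Fin 4 →₀ ℕ) : MvPolynomial (Fin 4) K :=
  if u.degree < v.degree then monomial u 1 else monomial u 1 - monomial v 1

/-- The degree never drops along a chain. A step of constant degree contributes its binomial; at the
first step that raises the degree, the least form is a monomial that already absorbs the current
one. -/
lemma monomial_sub_mem_or_of_reflTransGen (hd : ∀ i, DsGT (p i) (q i)) {u v : Fin 4 →₀ ℕ}
    (h : ReflTransGen (Step p q) u v) :
    (u.degree = v.degree → monomial u 1 - monomial v 1 ∈
      Ideal.span (Set.range fun i => binomialLeastForm K (p i) (q i))) ∧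
    (u.degree < v.degree → monomial u 1 ∈
      Ideal.span (Set.range fun i => binomialLeastForm K (p i) (q i))) := by
  induction h using ReflTransGen.head_induction_on with
  | refl => exact ⟨fun _ => by simp, fun h => absurd h (lt_irrefl _)⟩
  | @head u u' hs hr ih =>
    have hle := degree_le_of_sortKey_le (sortKey_le_of_reflTransGen hd hr)
    obtain ⟨i, s, rfl, rfl⟩ := hs
    have hi : binomialLeastForm K (p i) (q i) ∈
        Ideal.span (Set.range fun i => binomialLeastForm K (p i) (q i)) :=
      Ideal.subset_span ⟨i, rfl⟩
    have hpq : (p i).degree ≤ (q i).degree := degree_le_of_sortKey_le (sortKey_lt_iff.2 (hd i)).le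
    have hm := Ideal.mul_mem_left _ (monomial s 1) hi
    simp only [map_add] at hle ih ⊢
    rw [binomialLeastForm] at hm
    split_ifs at hm with hlt
    · rw [monomial_mul, mul_one, add_comm s] at hm
      exact ⟨fun h => by omega, fun _ => hm⟩
    · rw [mul_sub, monomial_mul, monomial_mul, mul_one, add_comm s, add_comm s] at hm
      refine ⟨fun h => ?_, fun h => ?_⟩
      · simpa using add_mem hm (ih.1 (by omega))
      · simpa using add_mem hm (ih.2 (by omega))

/-- The least forms of the rules generate the tangent ideal. -/
lemma span_binomialLeastForm (hw : ∀ i, weight n (p i) = weight n (q i))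
    (hd : ∀ i, DsGT (p i) (q i))
    (hjoin : ∀ u v, weight n u = weight n v → Join (ReflTransGen (Step p q)) u v) :
    Ideal.span (Set.range fun i => binomialLeastForm K (p i) (q i)) =
      tangentIdeal (toricIdeal K n) := by
  set G := Ideal.span (Set.range fun i => binomialLeastForm K (p i) (q i)) with hG
  have hlt : ∀ u v, weight n u = weight n v → u.degree < v.degree → monomial u 1 ∈ G := by
    intro u v h huv
    obtain ⟨w, hu, hv⟩ := hjoin u v h
    have := degree_le_of_sortKey_le (sortKey_le_of_reflTransGen hd hv)
    exact (monomial_sub_mem_or_of_reflTransGen hd hu).2 (by omega)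
  have heq : ∀ u v, weight n u = weight n v → u.degree = v.degree →
      monomial u 1 - monomial v 1 ∈ G := by
    intro u v h huv
    obtain ⟨w, hu, hv⟩ := hjoin u v h
    rcases (degree_le_of_sortKey_le (sortKey_le_of_reflTransGen hd hv)).lt_or_eq with hlt | heq
    · exact sub_mem ((monomial_sub_mem_or_of_reflTransGen hd hu).2 (by omega))
        ((monomial_sub_mem_or_of_reflTransGen hd hv).2 hlt)
    · simpa using sub_mem ((monomial_sub_mem_or_of_reflTransGen hd hu).1 (by omega))
        ((monomial_sub_mem_or_of_reflTransGen hd hv).1 heq)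
  refine le_antisymm (Ideal.span_le.2 ?_) (Ideal.span_le.2 ?_)
  · rintro _ ⟨i, rfl⟩
    have hpq : (p i).degree ≤ (q i).degree := degree_le_of_sortKey_le (sortKey_lt_iff.2 (hd i)).le
    simp only [binomialLeastForm]
    split_ifs with h
    · exact monomial_mem_tangentIdeal (hw i) h
    · exact monomial_sub_mem_tangentIdeal (hw i) (by omega)
  · rintro _ ⟨f, hf, rfl⟩
    obtain ⟨d, hd', hdf⟩ := exists_leastForm_eq f
    -- Modulo `G`, a monomial of degree `d` depends only on its weight. The default `0` is harmless,
    -- as `h` is constrained only at weights attained in degree `d`.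
    have hclass : ∃ h : ℕ → MvPolynomial (Fin 4) K ⧸ G, ∀ u : Fin 4 →₀ ℕ, u.degree = d →
        Ideal.Quotient.mk G (monomial u 1) = h (weight n u) := by
      classical
      refine ⟨fun w => if hu : ∃ u : Fin 4 →₀ ℕ, u.degree = d ∧ weight n u = w then
        Ideal.Quotient.mk G (monomial hu.choose 1) else 0, fun u hu => ?_⟩
      have hex : ∃ v : Fin 4 →₀ ℕ, v.degree = d ∧ weight n v = weight n u := ⟨u, hu, rfl⟩
      simp only [dif_pos hex]
      exact Ideal.Quotient.eq.2 (heq _ _ hex.choose_spec.2.symm (hu.trans hex.choose_spec.1.symm))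
    obtain ⟨h, hh⟩ := hclass
    rw [SetLike.mem_coe, ← Ideal.Quotient.eq_zero_iff_mem, hd', homogeneousComponent_apply, map_sum]
    have hterm : ∀ u ∈ f.support.filter fun u => u.degree = d,
        Ideal.Quotient.mk G (monomial u (coeff u f)) =
          Ideal.Quotient.mk G (C (coeff u f)) * h (weight n u) := fun u hu => by
      rw [← hh u (Finset.mem_filter.1 hu).2, ← map_mul, C_mul_monomial, mul_one]
    rw [Finset.sum_congr rfl hterm,
      ← Finset.sum_fiberwise_of_maps_to (t := (f.support.filter fun u => u.degree = d).image
        (weight n)) (fun u hu => Finset.mem_image_of_mem _ hu)]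
    refine Finset.sum_eq_zero fun w hwmem => ?_
    obtain ⟨u₀, hu₀, rfl⟩ := Finset.mem_image.1 hwmem
    rw [Finset.mem_filter] at hu₀
    -- If `f` has a term of this weight in higher degree, the degree `d` monomials of this weight
    -- lie in `G`. Otherwise all terms of `f` of this weight have degree `d`, and their coefficients
    -- cancel.
    by_cases hbig : ∃ v ∈ f.support, weight n v = weight n u₀ ∧ d < v.degree
    · obtain ⟨v, -, hvw, hv⟩ := hbig
      have h0 : h (weight n u₀) = 0 := by
        rw [← hh u₀ hu₀.2, Ideal.Quotient.eq_zero_iff_mem]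
        exact hlt u₀ v hvw.symm (hu₀.2 ▸ hv)
      refine Finset.sum_eq_zero fun u hu => ?_
      rw [(Finset.mem_filter.1 hu).2, h0, mul_zero]
    · push Not at hbig
      have hsum := mem_toricIdeal_iff.1 hf (weight n u₀)
      have hset : (f.support.filter fun u => u.degree = d).filter
          (fun u => weight n u = weight n u₀) =
          f.support.filter fun u => weight n u = weight n u₀ := by
        ext u
        simp only [Finset.mem_filter]
        exact ⟨fun h => ⟨h.1.1, h.2⟩, fun h =>
          ⟨⟨h.1, le_antisymm (hbig u h.1 h.2) (hdf u h.1)⟩, h.2⟩⟩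
      rw [hset, Finset.sum_congr rfl fun u hu => by rw [(Finset.mem_filter.1 hu).2],
        ← Finset.sum_mul, ← map_sum, ← map_sum, hsum, map_zero, map_zero, zero_mul]

/-- The least forms of the binomials `x ^ p i - x ^ q i` are irredundant if no `x ^ p i` divides
another one or involves `x_1`, and `x_1` divides `x ^ q i` whenever the degrees agree. -/
lemma binomialLeastForm_notMem_span {p q : ι → Fin 4 →₀ ℕ} (hp : ∀ i j, p i ≤ p j → i = j)
    (hp0 : ∀ i, p i 0 = 0) (hq0 : ∀ i, (p i).degree = (q i).degree → q i 0 ≠ 0)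
    (hle : ∀ i, (p i).degree ≤ (q i).degree) (i : ι) :
    binomialLeastForm K (p i) (q i) ∉
      Ideal.span ((fun i => binomialLeastForm K (p i) (q i)) '' {i}ᶜ) := by
  intro hmem
  -- Adjoining `x_1` absorbs every second monomial, so the other generators lie in a monomial ideal,
  -- where membership is tested by divisibility.
  have hsub : Ideal.span ((fun i => binomialLeastForm K (p i) (q i)) '' {i}ᶜ) ≤
      Ideal.span ((fun u => monomial u (1 : K)) '' (p '' {i}ᶜ ∪ {Finsupp.single 0 1})) := by
    refine Ideal.span_le.2 ?_
    rintro _ ⟨j, hj, rfl⟩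
    have hpj : monomial (p j) (1 : K) ∈
        Ideal.span ((fun u => monomial u (1 : K)) '' (p '' {i}ᶜ ∪ {Finsupp.single 0 1})) :=
      Ideal.subset_span ⟨_, Or.inl ⟨j, hj, rfl⟩, rfl⟩
    simp only [binomialLeastForm, SetLike.mem_coe]
    split_ifs with h
    · exact hpj
    · refine sub_mem hpj (mem_ideal_span_monomial_image.2 fun u hu =>
        ⟨_, Or.inr rfl, ?_⟩)
      rw [Finset.mem_singleton.1 (support_monomial_subset hu), Finsupp.single_le_iff]
      have := hle j
      exact Nat.one_le_iff_ne_zero.2 (hq0 j (by omega))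
  have hsupp : p i ∈ (binomialLeastForm K (p i) (q i)).support := by
    rw [mem_support_iff, binomialLeastForm]
    split_ifs with h
    · simp
    · have hne : q i ≠ p i := fun h' => hq0 i (by rw [h']) (by rw [h', hp0])
      simp [coeff_monomial, hne]
  obtain ⟨s, hs | hs, hsle⟩ := mem_ideal_span_monomial_image.1 (hsub hmem) _ hsupp
  · obtain ⟨j, hj, rfl⟩ := hs
    exact hj (hp j i hsle)
  · rw [Set.mem_singleton_iff.1 hs, Finsupp.single_le_iff, hp0] at hsle
    omega

end Rewriting

/-! ### Cohen–Macaulayness makes `x_1` a nonzerodivisor. -/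

section CohenMacaulay

variable {K : Type*} [Field K] {n : Fin 4 → ℕ}

lemma mem_ideal_span_range_X {a : MvPolynomial (Fin 4) K} (h : constantCoeff a = 0) :
    a ∈ Ideal.span (Set.range (X : Fin 4 → MvPolynomial (Fin 4) K)) := by
  rw [← Set.image_univ, mem_ideal_span_X_image]
  intro m hm
  by_contra! h0
  have : m = 0 := Finsupp.ext fun i => h0 i (Set.mem_univ i)
  rw [this, mem_support_iff] at hm
  exact hm h

/-- If `K[x_1, …, x_4] / J` is Cohen-Macaulay, where `J` lies in `(x_2, x_3, x_4)` and contains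
powers of `x_2, x_3, x_4`, then `x_1` is a nonzerodivisor modulo `J`. -/
lemma mem_of_X_zero_mul_mem {J : Ideal (MvPolynomial (Fin 4) K)}
    (hJ : J ≤ Ideal.span (X '' {0}ᶜ)) (hpow : ∀ i ≠ 0, ∃ k, (X i : MvPolynomial (Fin 4) K) ^ k ∈ J)
    (hCM : IsCohenMacaulay (MvPolynomial (Fin 4) K ⧸ J)) {f : MvPolynomial (Fin 4) K}
    (hf : X 0 * f ∈ J) : f ∈ J := by
  have hconst : ∀ a ∈ J, (constantCoeff : MvPolynomial (Fin 4) K →+* K) a = 0 := fun a ha => by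
    by_contra h
    obtain ⟨i, -, hi⟩ := mem_ideal_span_X_image.1 (hJ ha) 0 (mem_support_iff.2 h)
    exact hi rfl
  let φ : MvPolynomial (Fin 4) K ⧸ J →+* K := Ideal.Quotient.lift J constantCoeff hconst
  have hφ : ∀ a, φ (Ideal.Quotient.mk J a) = constantCoeff a := fun a => Ideal.Quotient.lift_mk _ _ _
  have hsurj : Function.Surjective φ := fun c => ⟨Ideal.Quotient.mk J (C c), by simp [hφ]⟩
  let M : Ideal (MvPolynomial (Fin 4) K ⧸ J) := RingHom.ker φ
  have hM : M.IsMaximal := RingHom.ker_isMaximal_of_surjective φ hsurj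
  obtain ⟨hlocal, -, rs, hreg, hlen⟩ := hCM.2 M
  let ψ : MvPolynomial (Fin 4) K →+* Localization.AtPrime M :=
    (algebraMap _ _).comp (Ideal.Quotient.mk J)
  have hψ : ∀ a, ψ a = 0 → ∃ s, constantCoeff s ≠ 0 ∧ s * a ∈ J := fun a ha => by
    obtain ⟨⟨s, hs⟩, hsa⟩ := (IsLocalization.map_eq_zero_iff M.primeCompl _ _).1 ha
    obtain ⟨s, rfl⟩ := Ideal.Quotient.mk_surjective s
    refine ⟨s, fun h => hs ((hφ s).trans h), ?_⟩
    rwa [← map_mul, Ideal.Quotient.eq_zero_iff_mem] at hsa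
  have hmax : ∀ a, constantCoeff a = 0 → ψ a ∈ IsLocalRing.maximalIdeal _ := fun a ha => by
    rw [← Localization.AtPrime.map_eq_maximalIdeal]
    exact Ideal.mem_map_of_mem _ (show Ideal.Quotient.mk J a ∈ M from (hφ a).trans ha)
  cases rs with
  -- An empty regular sequence means dimension zero at the origin, so `x_1` is locally nilpotent.
  -- Then some `s * x_1^k` with `s(0) ≠ 0` lies in `J`, and its pure `x_1^k` term contradicts `hJ`.
  | nil =>
    have hdim : Ring.KrullDimLE 0 (Localization.AtPrime M) := by
      rw [Ring.krullDimLE_iff, ← hlen]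
      simp
    obtain ⟨k, hk⟩ := Ring.KrullDimLE.isNilpotent_iff_mem_maximalIdeal.2
      (hmax (X 0) (constantCoeff_X _ _))
    rw [← map_pow] at hk
    obtain ⟨s, hs, hsk⟩ := hψ _ hk
    have hcoeff : coeff (Finsupp.single 0 k) (s * X 0 ^ k) = constantCoeff s := by
      rw [X_pow_eq_monomial, coeff_mul_monomial', if_pos le_rfl, tsub_self, mul_one,
        constantCoeff_eq]
    obtain ⟨i, hi, h0⟩ := mem_ideal_span_X_image.1 (hJ hsk) (Finsupp.single 0 k)
      (by rw [mem_support_iff, hcoeff]; exact hs)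
    exact absurd (Finsupp.single_eq_of_ne hi) h0
  | cons r rs =>
    have hr : r ∈ IsLocalRing.maximalIdeal (Localization.AtPrime M) := by
      by_contra h
      rw [IsLocalRing.mem_maximalIdeal, mem_nonunits_iff, not_not] at h
      refine hreg.top_ne_smul ?_
      rw [Ideal.ofList_cons, Ideal.span_singleton_eq_top.2 h, top_sup_eq, Submodule.top_smul]
    have hr' : IsSMulRegular (Localization.AtPrime M) r :=
      ((RingTheory.Sequence.isRegular_cons_iff _ _ _).1 hreg).1
    -- A power of every variable kills `f` modulo `J`, so a power of the regular element `r` kills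
    -- its image in the local ring.
    have hXf : ∀ i, ∃ k, X i ^ k * f ∈ J := fun i => by
      rcases eq_or_ne i 0 with rfl | hi
      · exact ⟨1, by rwa [pow_one]⟩
      · obtain ⟨k, hk⟩ := hpow i hi
        exact ⟨k, J.mul_mem_right _ hk⟩
    have hy : ψ f = 0 := by
      have hle : IsLocalRing.maximalIdeal (Localization.AtPrime M) ≤
          (Submodule.span (Localization.AtPrime M) {ψ f}).annihilator.radical := by
        rw [← Localization.AtPrime.map_eq_maximalIdeal, Ideal.map_le_iff_le_comap]
        intro a ha
        obtain ⟨a, rfl⟩ := Ideal.Quotient.mk_surjective a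
        rw [RingHom.mem_ker, hφ] at ha
        refine (Ideal.span_le (I := Ideal.comap ψ _)).2 ?_ (mem_ideal_span_range_X ha)
        rintro _ ⟨i, rfl⟩
        obtain ⟨k, hk⟩ := hXf i
        refine ⟨k, ?_⟩
        rw [Submodule.mem_annihilator_span_singleton, smul_eq_mul, ← map_pow, ← map_mul]
        rw [RingHom.comp_apply, Ideal.Quotient.eq_zero_iff_mem.2 hk, map_zero]
      obtain ⟨k, hk⟩ := hle hr
      rw [Submodule.mem_annihilator_span_singleton] at hk
      exact (hr'.pow k).right_eq_zero_of_smul hk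
    -- From local to global: the annihilator `Q` contains `s` with `s(0) ≠ 0` as well as a power of
    -- each variable, so it is the unit ideal.
    obtain ⟨s, hs, hsf⟩ := hψ f hy
    set Q : Ideal (MvPolynomial (Fin 4) K) :=
      (Submodule.span (MvPolynomial (Fin 4) K) {Ideal.Quotient.mk J f}).annihilator with hQ
    have hmem : ∀ a, a ∈ Q ↔ a * f ∈ J := fun a => by
      rw [hQ, Submodule.mem_annihilator_span_singleton, ← Ideal.Quotient.eq_zero_iff_mem, map_mul]
      rfl
    have hX : Ideal.span (Set.range (X : Fin 4 → MvPolynomial (Fin 4) K)) ≤ Q.radical := by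
      refine Ideal.span_le.2 ?_
      rintro _ ⟨i, rfl⟩
      obtain ⟨k, hk⟩ := hXf i
      exact ⟨k, (hmem _).2 hk⟩
    have htop : Q = ⊤ := by
      rw [← Ideal.radical_eq_top]
      refine Ideal.eq_top_of_isUnit_mem _ (x := C (constantCoeff s)) ?_
        ((isUnit_iff_ne_zero.2 hs).map C)
      have h1 : s - C (constantCoeff s) ∈ Q.radical :=
        hX (mem_ideal_span_range_X (by simp))
      simpa using sub_mem (Ideal.le_radical ((hmem s).2 hsf)) h1
    simpa using (hmem 1).1 (htop ▸ Submodule.mem_top)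

end CohenMacaulay

/-! ### The tangent cone of a monomial curve. -/

section Curve

variable {K : Type*} [Field K] {n : Fin 4 → ℕ}

/-- As `x_1` has the smallest weight, `x_1^d` is the only monomial of its weight and of degree at
least `d`. If it occurred in a least form of degree `d`, its coefficient would be the whole
coefficient sum of that weight, which is zero. -/
lemma tangentIdeal_le_span_X (hn : IsCurve n) :
    tangentIdeal (toricIdeal K n) ≤ Ideal.span (X '' {0}ᶜ) := by
  refine Ideal.span_le.2 ?_
  rintro _ ⟨f, hf, rfl⟩
  refine mem_ideal_span_X_image.2 fun m hm => ?_
  by_contra! h0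
  obtain ⟨d, hd, hdf⟩ := exists_leastForm_eq f
  rw [mem_support_iff, hd, coeff_homogeneousComponent] at hm
  obtain rfl : m.degree = d := by
    by_contra h
    exact hm (if_neg h)
  rw [if_pos rfl] at hm
  have hm1 : m 1 = 0 := h0 1 (by simp)
  have hm2 : m 2 = 0 := h0 2 (by simp)
  have hm3 : m 3 = 0 := h0 3 (by simp)
  refine hm ?_
  rw [← mem_toricIdeal_iff.1 hf (weight n m), Finset.sum_eq_single_of_mem m]
  · simpa using hm
  intro u hu hne
  obtain ⟨hu, huw⟩ := Finset.mem_filter.1 hu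
  refine absurd ?_ hne
  have hdeg := hdf u hu
  have h1 : n 0 < n 1 := hn.strictMono (by decide)
  have h2 : n 0 < n 2 := hn.strictMono (by decide)
  have h3 : n 0 < n 3 := hn.strictMono (by decide)
  have hpos := hn.pos 0
  simp only [Finsupp.degree_eq_sum, weight, Fin.sum_univ_four, hm1, hm2, hm3] at hdeg huw
  -- Subtract `n 0` times the degree inequality from the equality of weights.
  have hlin : (n 1 - n 0) * u 1 + (n 2 - n 0) * u 2 + (n 3 - n 0) * u 3 = 0 := by
    zify [h1.le, h2.le, h3.le] at *
    nlinarith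
  have hu1 : u 1 = 0 := by
    have := Nat.eq_zero_of_add_eq_zero_right (Nat.eq_zero_of_add_eq_zero_right hlin)
    exact (Nat.mul_eq_zero.1 this).resolve_left (by omega)
  have hu2 : u 2 = 0 := by
    have := Nat.eq_zero_of_add_eq_zero_left (Nat.eq_zero_of_add_eq_zero_right hlin)
    exact (Nat.mul_eq_zero.1 this).resolve_left (by omega)
  have hu3 : u 3 = 0 := by
    have := Nat.eq_zero_of_add_eq_zero_left hlin
    exact (Nat.mul_eq_zero.1 this).resolve_left (by omega)
  have hu0 : u 0 = m 0 := by
    rw [hu1, hu2, hu3] at huw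
    exact Nat.eq_of_mul_eq_mul_left hpos (by simpa using huw)
  ext i
  fin_cases i
  exacts [hu0, hu1.trans hm1.symm, hu2.trans hm2.symm, hu3.trans hm3.symm]

lemma exists_X_pow_mem_tangentIdeal (hn : IsCurve n) (i : Fin 4) (hi : i ≠ 0) :
    ∃ k, (X i : MvPolynomial (Fin 4) K) ^ k ∈ tangentIdeal (toricIdeal K n) := by
  -- The binomial `x_i^{n_1} - x_1^{n_i}` lies in `I(C)`, and its first monomial has the smaller
  -- degree.
  refine ⟨n 0, ?_⟩
  rw [X_pow_eq_monomial]
  refine monomial_mem_tangentIdeal (q := Finsupp.single 0 (n i)) ?_ ?_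
  · simp [weight, Finsupp.single_apply, mul_comm]
  · simpa using hn.strictMono (Fin.pos_iff_ne_zero.2 hi)

/-- For a curve with Cohen-Macaulay tangent cone, powers of `x_1` can be cancelled modulo `I_*`. -/
lemma monomial_mem_of_add_single_mem (hn : IsCurve n) (hCM : HasCMTangentCone K n)
    {u : Fin 4 →₀ ℕ} {k : ℕ}
    (h : monomial (u + Finsupp.single 0 k) 1 ∈ tangentIdeal (toricIdeal K n)) :
    monomial u 1 ∈ tangentIdeal (toricIdeal K n) := by
  induction k with
  | zero => simpa using h
  | succ k ih =>
    refine ih (mem_of_X_zero_mul_mem (tangentIdeal_le_span_X hn)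
      (exists_X_pow_mem_tangentIdeal hn) hCM ?_)
    rw [X, monomial_mul, one_mul]
    convert h using 2
    rw [Finsupp.single_add, add_comm, add_assoc]

end Curve

/-! ### Exponents of the generators and relations between them. -/

/-- The exponent vector of `x_1 ^ a * x_2 ^ b * x_3 ^ c * x_4 ^ d`. -/
def expVec (a b c d : ℕ) : Fin 4 →₀ ℕ := Finsupp.equivFunOnFinite.symm ![a, b, c, d]

section ExpVec

variable (a b c d : ℕ)

@[simp] lemma expVec_zero : expVec a b c d 0 = a := rfl
@[simp] lemma expVec_one : expVec a b c d 1 = b := rfl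
@[simp] lemma expVec_two : expVec a b c d 2 = c := rfl
@[simp] lemma expVec_three : expVec a b c d 3 = d := rfl

lemma degree_expVec : (expVec a b c d).degree = a + b + c + d := by
  simp [Finsupp.degree_eq_sum, Fin.sum_univ_four]

lemma weight_expVec (n : Fin 4 → ℕ) :
    weight n (expVec a b c d) = n 0 * a + n 1 * b + n 2 * c + n 3 * d := by
  simp [weight, Fin.sum_univ_four]

lemma monomial_expVec (K : Type*) [Field K] :
    monomial (expVec a b c d) (1 : K) = X 0 ^ a * X 1 ^ b * X 2 ^ c * X 3 ^ d := by
  rw [monomial_eq, Finsupp.prod_fintype _ _ (by simp), Fin.prod_univ_four]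
  simp

variable {a b c d}

lemma expVec_le_iff {u : Fin 4 →₀ ℕ} :
    expVec a b c d ≤ u ↔ a ≤ u 0 ∧ b ≤ u 1 ∧ c ≤ u 2 ∧ d ≤ u 3 := by
  simp [Finsupp.le_def, Fin.forall_fin_succ]

lemma eq_iff_forall_coord {u v : Fin 4 →₀ ℕ} :
    u = v ↔ u 0 = v 0 ∧ u 1 = v 1 ∧ u 2 = v 2 ∧ u 3 = v 3 := by
  simp [Finsupp.ext_iff, Fin.forall_fin_succ]

end ExpVec

/-- The exponents of the first monomials of `f_1, …, f_5`. -/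
def genFst (e : Exponents) : Fin 5 → Fin 4 →₀ ℕ :=
  ![expVec e.a1 0 0 0, expVec 0 e.a2 0 0, expVec 0 0 e.a3 0, expVec 0 0 0 e.a4,
    expVec e.a41 e.a32 0 0]

/-- The exponents of the second monomials of `f_1, …, f_5`. -/
def genSnd (e : Exponents) : Fin 5 → Fin 4 →₀ ℕ :=
  ![expVec 0 e.a12 e.a13 0, expVec e.a21 0 0 e.a24, expVec 0 e.a32 0 e.a34,
    expVec e.a41 0 e.a43 0, expVec 0 0 e.a13 e.a24]

/-- None of the monomials of `f_1, …, f_5` divides `x ^ u`. -/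
def AvoidsGenerators (e : Exponents) (u : Fin 4 →₀ ℕ) : Prop :=
  ∀ i, ¬ genFst e i ≤ u ∧ ¬ genSnd e i ≤ u

section Case2b

variable {K : Type*} [Field K] {n : Fin 4 → ℕ} {e : Exponents}

lemma GivenAsCase2b.span_eq (he : GivenAsCase2b K e n) :
    Ideal.span (Set.range fun i => monomial (genFst e i) (1 : K) - monomial (genSnd e i) 1) =
      toricIdeal K n := by
  rw [← he.generated.1]
  congr 2
  funext i
  fin_cases i <;> simp [genFst, genSnd, monomial_expVec, f1, f2, f3, f4, f5]

lemma GivenAsCase2b.weight_eq (he : GivenAsCase2b K e n) (i : Fin 5) :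
    weight n (genFst e i) = weight n (genSnd e i) := by
  rw [← monomial_sub_mem_toricIdeal_iff (K := K), ← he.span_eq]
  exact Ideal.subset_span ⟨i, rfl⟩

lemma GivenAsCase2b.toricIdeal_le (he : GivenAsCase2b K e n) :
    toricIdeal K n ≤ Ideal.span ((fun u => monomial u (1 : K)) ''
      (Set.range (genFst e) ∪ Set.range (genSnd e))) := by
  rw [← he.span_eq, Ideal.span_le]
  rintro _ ⟨i, rfl⟩
  exact sub_mem (Ideal.subset_span ⟨_, Or.inl ⟨i, rfl⟩, rfl⟩)
    (Ideal.subset_span ⟨_, Or.inr ⟨i, rfl⟩, rfl⟩)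

lemma AvoidsGenerators.notMem_support {u : Fin 4 →₀ ℕ} (hu : AvoidsGenerators e u)
    {f : MvPolynomial (Fin 4) K} (hf : f ∈ Ideal.span ((fun u => monomial u (1 : K)) ''
      (Set.range (genFst e) ∪ Set.range (genSnd e)))) : u ∉ f.support := fun h => by
  obtain ⟨_, ⟨i, rfl⟩ | ⟨i, rfl⟩, hi⟩ := mem_ideal_span_monomial_image.1 hf u h
  exacts [(hu i).1 hi, (hu i).2 hi]

/-- Every term of an element of `I(C)` is divisible by a monomial of some generator, so `x ^ u`
cannot occur in a nonzero binomial of `I(C)`. -/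
lemma AvoidsGenerators.eq_of_weight_eq {u v : Fin 4 →₀ ℕ} (hu : AvoidsGenerators e u)
    (he : GivenAsCase2b K e n) (h : weight n u = weight n v) : u = v := by
  by_contra hne
  refine hu.notMem_support (he.toricIdeal_le (monomial_sub_mem_toricIdeal_iff.2 h)) ?_
  rw [mem_support_iff]
  simp [coeff_monomial, Ne.symm hne]

lemma AvoidsGenerators.notMem_tangentIdeal {u : Fin 4 →₀ ℕ} (hu : AvoidsGenerators e u)
    (he : GivenAsCase2b K e n) : monomial u 1 ∉ tangentIdeal (toricIdeal K n) := fun h =>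
  hu.notMem_support (tangentIdeal_le_of_le he.toricIdeal_le h) (by simp)

/-- If `x ^ u` is divisible by no monomial of `f_1, …, f_5` then no monomial of the same weight as
`x_1 ^ k * x ^ u` has larger degree. -/
lemma AvoidsGenerators.degree_le (hn : IsCurve n) (hCM : HasCMTangentCone K n)
    (he : GivenAsCase2b K e n) {u v : Fin 4 →₀ ℕ} (hu : AvoidsGenerators e u) {k : ℕ}
    (h : weight n (u + Finsupp.single 0 k) = weight n v) : v.degree ≤ u.degree + k := by
  by_contra! hlt
  refine hu.notMem_tangentIdeal he (monomial_mem_of_add_single_mem hn hCM (k := k)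
    (monomial_mem_tangentIdeal h ?_))
  simpa using hlt

lemma avoidsGenerators_expVec_iff {a b c d : ℕ} : AvoidsGenerators e (expVec a b c d) ↔
    a < e.a1 ∧ b < e.a2 ∧ c < e.a3 ∧ d < e.a4 ∧ (a < e.a41 ∨ b < e.a32) ∧
      (b < e.a12 ∨ c < e.a13) ∧ (a < e.a21 ∨ d < e.a24) ∧ (b < e.a32 ∨ d < e.a34) ∧
      (a < e.a41 ∨ c < e.a43) ∧ (c < e.a13 ∨ d < e.a24) := by
  simp only [AvoidsGenerators, genFst, genSnd, Fin.forall_fin_succ]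
  simp [expVec_le_iff]
  omega

/-- Combining the weights of `f_1, …, f_5` yields pairs of monomials of equal weight, one of which
avoids all generators. Such pairs coincide, which forces the exponents to match. -/
lemma GivenAsCase2b.sums (hn : IsCurve n) (he : GivenAsCase2b K e n) :
    e.a1 = e.a21 + e.a41 ∧ e.a2 = e.a12 + e.a32 ∧ e.a3 = e.a13 + e.a43 ∧
      e.a4 = e.a24 + e.a34 := by
  obtain ⟨h12, h13, h21, h24, h32, h34, h41, h43, -⟩ := id he
  have w1 := he.weight_eq 0
  have w2 := he.weight_eq 1
  have w3 := he.weight_eq 2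
  have w4 := he.weight_eq 3
  have w5 := he.weight_eq 4
  simp [genFst, genSnd, weight_expVec] at w1 w2 w3 w4 w5
  obtain ⟨d, hd⟩ := Nat.exists_eq_add_of_lt h41.2
  obtain ⟨g, hg⟩ := Nat.exists_eq_add_of_lt h24.2
  have n0 := hn.pos 0
  have n3 := hn.pos 3
  have key : ∀ {u v : Fin 4 →₀ ℕ}, AvoidsGenerators e u → weight n u = weight n v →
      u 0 = v 0 ∧ u 1 = v 1 ∧ u 2 = v 2 ∧ u 3 = v 3 := fun hu h =>
    eq_iff_forall_coord.1 (hu.eq_of_weight_eq he h)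
  -- Here `d + 1 = a_1 - a_41`; by `f_1` and `f_5`, `x_2^{a_12 + a_32}` has the weight of `x_1^{d +
  -- 1} x_4^{a_24}`.
  have h2 : e.a2 ≤ e.a12 + e.a32 := by
    by_contra! hlt
    have := key (u := expVec 0 (e.a12 + e.a32) 0 0) (v := expVec (d + 1) 0 0 e.a24)
      (avoidsGenerators_expVec_iff.2 (by omega)) (by
        rw [hd] at w1
        simp only [weight_expVec]
        linarith)
    simp at this
  obtain ⟨c, hc⟩ := Nat.exists_eq_add_of_le h2
  have hd1 : n 1 * c + n 0 * e.a21 = n 0 * (d + 1) := by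
    have := congrArg (n 1 * ·) hc
    simp only [mul_add] at this
    rw [hd] at w1
    linarith
  obtain ⟨d', hd'⟩ : ∃ d', d + 1 = e.a21 + d' := Nat.exists_eq_add_of_le <|
    Nat.le_of_mul_le_mul_left (hd1 ▸ Nat.le_add_left _ _) n0
  -- Cancelling `f_2` leaves `x_2^c` and `x_1^{d'}` of equal weight, where `c` and `d'` are the
  -- defects in the formulas for `a_2` and `a_1`.
  have hc0 := key (u := expVec 0 c 0 0) (v := expVec d' 0 0 0)
    (avoidsGenerators_expVec_iff.2 (by omega)) (by
      rw [hd'] at hd1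
      simp only [weight_expVec]
      linarith)
  simp at hc0
  -- The same argument with `f_4` and `f_5`, then `f_3`, treats `a_3` and `a_4`; here `g + 1 = a_4 -
  -- a_24`.
  have h3 : e.a3 ≤ e.a13 + e.a43 := by
    by_contra! hlt
    have := key (u := expVec 0 0 (e.a13 + e.a43) 0) (v := expVec 0 e.a32 0 (g + 1))
      (avoidsGenerators_expVec_iff.2 (by omega)) (by
        rw [hg] at w4
        simp only [weight_expVec]
        linarith)
    simp at this
  obtain ⟨c', hc'⟩ := Nat.exists_eq_add_of_le h3
  have hg1 : n 2 * c' + n 3 * e.a34 = n 3 * (g + 1) := by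
    have := congrArg (n 2 * ·) hc'
    simp only [mul_add] at this
    rw [hg] at w4
    linarith
  obtain ⟨g', hg'⟩ : ∃ g', g + 1 = e.a34 + g' := Nat.exists_eq_add_of_le <|
    Nat.le_of_mul_le_mul_left (hg1 ▸ Nat.le_add_left _ _) n3
  have hg0 := key (u := expVec 0 0 c' 0) (v := expVec 0 0 0 g')
    (avoidsGenerators_expVec_iff.2 (by omega)) (by
      rw [hg'] at hg1
      simp only [weight_expVec]
      linarith)
  simp at hg0
  omega

end Case2b

/-! ### Critical pairs of the six rules. -/

section Join

variable {ι : Type*} {p q : ι → Fin 4 →₀ ℕ} {u v : Fin 4 →₀ ℕ}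

lemma step_of_le (i : ι) (h : p i ≤ u) : Step p q u (u - p i + q i) :=
  ⟨i, u - p i, (add_tsub_cancel_of_le h).symm, add_comm _ _⟩

lemma join_symm (h : Join (ReflTransGen (Step p q)) u v) :
    Join (ReflTransGen (Step p q)) v u :=
  let ⟨w, hu, hv⟩ := h
  ⟨w, hv, hu⟩

lemma join_of_le (i : ι) (h : p i ≤ v) (huv : v - p i + q i = u) :
    Join (ReflTransGen (Step p q)) u v :=
  ⟨u, .refl, .single (huv ▸ step_of_le i h)⟩

lemma join_of_le_of_le (i j : ι) (hu : p i ≤ u) (hv : p j ≤ v)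
    (huv : u - p i + q i = v - p j + q j) : Join (ReflTransGen (Step p q)) u v :=
  ⟨_, .single (step_of_le i hu), .single (huv ▸ step_of_le j hv)⟩

lemma join_of_two_le (i j : ι) (hi : p i ≤ v) (hj : p j ≤ v - p i + q i)
    (huv : v - p i + q i - p j + q j = u) : Join (ReflTransGen (Step p q)) u v :=
  ⟨u, .refl, .head (step_of_le i hi) (.single (huv ▸ step_of_le j hj))⟩

/-- If overlaps of distinct rules are joinable then the rewriting is locally confluent. -/
lemma locally_confluent_of_lt [LinearOrder ι]
    (h : ∀ i j, i < j → ∀ s t, p i + s = p j + t →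
      Join (ReflTransGen (Step p q)) (q i + s) (q j + t))
    (u v w : Fin 4 →₀ ℕ) (huv : Step p q u v) (huw : Step p q u w) :
    Join (ReflTransGen (Step p q)) v w := by
  obtain ⟨i, s, rfl, rfl⟩ := huv
  obtain ⟨j, t, hst, rfl⟩ := huw
  rcases lt_trichotomy i j with hij | rfl | hij
  · exact h i j hij s t hst
  · rw [add_left_cancel hst]
    exact ⟨_, .refl, .refl⟩
  · obtain ⟨x, hx, hx'⟩ := h j i hij t s hst.symm
    exact ⟨x, hx', hx⟩

end Join

/-- `x_1 ^ m0 * x_2 ^ m1 * x_4 ^ m3` is the second monomial of the sixth standard basis element. -/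
def IsSixthTail (e : Exponents) (m0 m1 m3 : ℕ) : Prop :=
  (e.a32 < e.a12 ∧ m0 = e.a41 ∧ m1 = 2 * e.a32 ∧ m3 = e.a34 - e.a24) ∨
    (e.a12 ≤ e.a32 ∧ m0 = e.a1 ∧ m1 = e.a32 - e.a12 ∧ m3 = e.a34)

/-- The exponents of the leading monomials of the standard basis. -/
def ruleFst (e : Exponents) : Fin 6 → Fin 4 →₀ ℕ :=
  ![expVec 0 e.a12 e.a13 0, expVec 0 e.a2 0 0, expVec 0 e.a32 0 e.a34, expVec 0 0 0 e.a4,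
    expVec 0 0 e.a13 e.a24, expVec 0 0 (e.a3 + e.a13) 0]

/-- The exponents of the second monomials of the standard basis. -/
def ruleSnd (e : Exponents) (m0 m1 m3 : ℕ) : Fin 6 → Fin 4 →₀ ℕ :=
  ![expVec e.a1 0 0 0, expVec e.a21 0 0 e.a24, expVec 0 0 e.a3 0, expVec e.a41 0 e.a43 0,
    expVec e.a41 e.a32 0 0, expVec m0 m1 0 m3]

section Rules

variable {K : Type*} [Field K] {n : Fin 4 → ℕ} {e : Exponents} {m0 m1 m3 : ℕ}

@[simp] lemma ruleFst_zero : ruleFst e 0 = expVec 0 e.a12 e.a13 0 := rfl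
@[simp] lemma ruleFst_one : ruleFst e 1 = expVec 0 e.a2 0 0 := rfl
@[simp] lemma ruleFst_two : ruleFst e 2 = expVec 0 e.a32 0 e.a34 := rfl
@[simp] lemma ruleFst_three : ruleFst e 3 = expVec 0 0 0 e.a4 := rfl
@[simp] lemma ruleFst_four : ruleFst e 4 = expVec 0 0 e.a13 e.a24 := rfl
@[simp] lemma ruleFst_five : ruleFst e 5 = expVec 0 0 (e.a3 + e.a13) 0 := rfl
@[simp] lemma ruleSnd_zero : ruleSnd e m0 m1 m3 0 = expVec e.a1 0 0 0 := rfl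
@[simp] lemma ruleSnd_one : ruleSnd e m0 m1 m3 1 = expVec e.a21 0 0 e.a24 := rfl
@[simp] lemma ruleSnd_two : ruleSnd e m0 m1 m3 2 = expVec 0 0 e.a3 0 := rfl
@[simp] lemma ruleSnd_three : ruleSnd e m0 m1 m3 3 = expVec e.a41 0 e.a43 0 := rfl
@[simp] lemma ruleSnd_four : ruleSnd e m0 m1 m3 4 = expVec e.a41 e.a32 0 0 := rfl
@[simp] lemma ruleSnd_five : ruleSnd e m0 m1 m3 5 = expVec m0 m1 0 m3 := rfl

-- Fifteen pairs of rules are checked for each form of the sixth tail. At most two further steps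
-- close each pair; the relations from `GivenAsCase2b.sums` make the resulting exponents agree.
set_option linter.unusedSimpArgs false in
set_option maxHeartbeats 1000000 in
lemma join_of_overlap (hn : IsCurve n) (he : GivenAsCase2b K e n) (h4 : e.a24 ≤ e.a34)
    (hm : IsSixthTail e m0 m1 m3) (i j : Fin 6) (hij : i < j) (s t : Fin 4 →₀ ℕ)
    (h : ruleFst e i + s = ruleFst e j + t) :
    Join (ReflTransGen (Step (ruleFst e) (ruleSnd e m0 m1 m3)))
      (ruleSnd e m0 m1 m3 i + s) (ruleSnd e m0 m1 m3 j + t) := by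
  obtain ⟨h12, h13, h21, h24, h32, h34, h41, h43, -⟩ := id he
  obtain ⟨s1, s2, s3, s4⟩ := he.sums hn
  rw [eq_iff_forall_coord] at h
  rcases hm with ⟨hc, rfl, rfl, rfl⟩ | ⟨hc, rfl, rfl, rfl⟩ <;> fin_cases i <;> fin_cases j <;>
    first
    | exact absurd hij (by decide)
    | simp at h
  · refine join_of_le 4 ?_ ?_ <;> simp [expVec_le_iff, eq_iff_forall_coord] <;> omega
  · refine join_of_two_le 5 1 ?_ ?_ ?_ <;> simp [expVec_le_iff, eq_iff_forall_coord] <;> omega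
  · refine join_of_le_of_le 3 0 ?_ ?_ ?_ <;> simp [expVec_le_iff, eq_iff_forall_coord] <;> omega
  · refine join_of_le 1 ?_ ?_ <;> simp [expVec_le_iff, eq_iff_forall_coord] <;> omega
  · refine join_of_two_le 1 2 ?_ ?_ ?_ <;> simp [expVec_le_iff, eq_iff_forall_coord] <;> omega
  · refine join_of_le_of_le 3 0 ?_ ?_ ?_ <;> simp [expVec_le_iff, eq_iff_forall_coord] <;> omega
  · refine join_of_le_of_le 3 1 ?_ ?_ ?_ <;> simp [expVec_le_iff, eq_iff_forall_coord] <;> omega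
  · refine join_of_le_of_le 4 1 ?_ ?_ ?_ <;> simp [expVec_le_iff, eq_iff_forall_coord] <;> omega
  · refine join_of_le_of_le 5 1 ?_ ?_ ?_ <;> simp [expVec_le_iff, eq_iff_forall_coord] <;> omega
  · refine join_symm (join_of_le 4 ?_ ?_) <;> simp [expVec_le_iff, eq_iff_forall_coord] <;> omega
  -- The overlap of `f_3` and `f_5`: the sixth rule itself closes this pair.
  · refine join_symm (join_of_le 5 ?_ ?_) <;> simp [expVec_le_iff, eq_iff_forall_coord] <;> omega
  · refine join_of_le_of_le 5 2 ?_ ?_ ?_ <;> simp [expVec_le_iff, eq_iff_forall_coord] <;> omega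
  · refine join_of_le 2 ?_ ?_ <;> simp [expVec_le_iff, eq_iff_forall_coord] <;> omega
  · refine join_of_le_of_le 5 3 ?_ ?_ ?_ <;> simp [expVec_le_iff, eq_iff_forall_coord] <;> omega
  · refine join_of_le 2 ?_ ?_ <;> simp [expVec_le_iff, eq_iff_forall_coord] <;> omega
  · refine join_of_le 4 ?_ ?_ <;> simp [expVec_le_iff, eq_iff_forall_coord] <;> omega
  -- When `a_12 ≤ a_32`, the sixth rule closes the overlap of `f_1` and `f_3` instead.
  · refine join_of_le 5 ?_ ?_ <;> simp [expVec_le_iff, eq_iff_forall_coord] <;> omega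
  · refine join_of_le_of_le 3 0 ?_ ?_ ?_ <;> simp [expVec_le_iff, eq_iff_forall_coord] <;> omega
  · refine join_of_le 1 ?_ ?_ <;> simp [expVec_le_iff, eq_iff_forall_coord] <;> omega
  · refine join_of_le 2 ?_ ?_ <;> simp [expVec_le_iff, eq_iff_forall_coord] <;> omega
  · refine join_of_le_of_le 3 0 ?_ ?_ ?_ <;> simp [expVec_le_iff, eq_iff_forall_coord] <;> omega
  · refine join_of_le_of_le 3 1 ?_ ?_ ?_ <;> simp [expVec_le_iff, eq_iff_forall_coord] <;> omega
  · refine join_of_le_of_le 4 1 ?_ ?_ ?_ <;> simp [expVec_le_iff, eq_iff_forall_coord] <;> omega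
  · refine join_of_le_of_le 5 1 ?_ ?_ ?_ <;> simp [expVec_le_iff, eq_iff_forall_coord] <;> omega
  · refine join_symm (join_of_le 4 ?_ ?_) <;> simp [expVec_le_iff, eq_iff_forall_coord] <;> omega
  · refine join_of_le_of_le 5 1 ?_ ?_ ?_ <;> simp [expVec_le_iff, eq_iff_forall_coord] <;> omega
  · refine join_of_le_of_le 5 2 ?_ ?_ ?_ <;> simp [expVec_le_iff, eq_iff_forall_coord] <;> omega
  · refine join_of_le 2 ?_ ?_ <;> simp [expVec_le_iff, eq_iff_forall_coord] <;> omega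
  · refine join_of_le_of_le 5 3 ?_ ?_ ?_ <;> simp [expVec_le_iff, eq_iff_forall_coord] <;> omega
  · refine join_of_le_of_le 0 3 ?_ ?_ ?_ <;> simp [expVec_le_iff, eq_iff_forall_coord] <;> omega

end Rules

/-! ### Orientation of the rules and the conclusion. -/

section Rules

variable {K : Type*} [Field K] {n : Fin 4 → ℕ} {e : Exponents} {m0 m1 m3 : ℕ}

lemma weight_rule (he : GivenAsCase2b K e n) (h4 : e.a24 ≤ e.a34)
    (hm : IsSixthTail e m0 m1 m3) (i : Fin 6) :
    weight n (ruleFst e i) = weight n (ruleSnd e m0 m1 m3 i) := by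
  have w1 := he.weight_eq 0
  have w2 := he.weight_eq 1
  have w3 := he.weight_eq 2
  have w4 := he.weight_eq 3
  have w5 := he.weight_eq 4
  simp [genFst, genSnd, weight_expVec] at w1 w2 w3 w4 w5
  fin_cases i <;> simp [weight_expVec]
  · exact w1.symm
  · exact w2
  · exact w3.symm
  · exact w4
  · exact w5.symm
  -- The weight of `f_6` is obtained by adding the relations of `f_3` and `f_5`, respectively of
  -- `f_3` and `f_1`.
  · rcases hm with ⟨-, rfl, rfl, rfl⟩ | ⟨hc, rfl, rfl, rfl⟩
    · obtain ⟨k, hk⟩ := Nat.exists_eq_add_of_le h4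
      rw [hk, Nat.add_sub_cancel_left]
      rw [hk] at w3
      linarith
    · obtain ⟨k, hk⟩ := Nat.exists_eq_add_of_le hc
      rw [hk, Nat.add_sub_cancel_left]
      rw [hk] at w3
      linarith

/-- The `x_1`-free part `x_2^{m1} x_4^{m3}` of the tail avoids all generators, so
`AvoidsGenerators.degree_le` bounds the degree of anything of the same weight as the tail. -/
lemma sixth_degree_le (hn : IsCurve n) (hCM : HasCMTangentCone K n) (he : GivenAsCase2b K e n)
    (h4 : e.a24 ≤ e.a34) (hm : IsSixthTail e m0 m1 m3) : e.a3 + e.a13 ≤ m0 + m1 + m3 := by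
  obtain ⟨h12, h13, h21, h24, h32, h34, h41, h43, -⟩ := id he
  obtain ⟨s1, s2, s3, s4⟩ := he.sums hn
  have hu : AvoidsGenerators e (expVec 0 m1 0 m3) :=
    avoidsGenerators_expVec_iff.2 (by rcases hm with hm | hm <;> omega)
  have hw := weight_rule he h4 hm 5
  have := hu.degree_le hn hCM he (k := m0) (v := ruleFst e 5) (by
    rw [hw]
    congr 1
    simp [eq_iff_forall_coord])
  simp [degree_expVec] at this
  omega

lemma second_degree_le (hn : IsCurve n) (hCM : HasCMTangentCone K n) (he : GivenAsCase2b K e n) :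
    e.a2 ≤ e.a21 + e.a24 := by
  obtain ⟨h12, h13, h21, h24, h32, h34, h41, h43, -⟩ := id he
  have hu : AvoidsGenerators e (expVec 0 0 0 e.a24) :=
    avoidsGenerators_expVec_iff.2 (by have := he.sums hn; omega)
  have hw := he.weight_eq 1
  have := hu.degree_le hn hCM he (k := e.a21) (v := genFst e 1) (by
    rw [hw]
    congr 1
    simp [eq_iff_forall_coord, genSnd])
  simp [degree_expVec, genFst] at this
  omega

lemma ruleFst_apply_zero (i : Fin 6) : ruleFst e i 0 = 0 := by fin_cases i <;> rfl

/-- For `f_1`, `f_4` and `f_5` strictness follows from `n` being increasing, comparing weights with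
multiples of `n 0`, `n 3` and `n 2` respectively; for `f_3` it is `h3`. Only `f_2` and `f_6` may be
homogeneous, and then `x_1`, present only in the tail, breaks the tie. -/
lemma degree_rule (hn : IsCurve n) (hCM : HasCMTangentCone K n) (he : GivenAsCase2b K e n)
    (h3 : e.a32 + e.a34 < e.a3) (h4 : e.a24 ≤ e.a34) (hm : IsSixthTail e m0 m1 m3) (i : Fin 6) :
    (ruleFst e i).degree < (ruleSnd e m0 m1 m3 i).degree ∨ (i = 1 ∨ i = 5) ∧
      (ruleFst e i).degree ≤ (ruleSnd e m0 m1 m3 i).degree ∧ 0 < ruleSnd e m0 m1 m3 i 0 := by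
  obtain ⟨h12, h13, h21, h24, h32, h34, h41, h43, -⟩ := id he
  have n1 : n 0 < n 1 := hn.strictMono (by decide)
  have n2 : n 1 < n 2 := hn.strictMono (by decide)
  have n3 : n 2 < n 3 := hn.strictMono (by decide)
  have w1 := he.weight_eq 0
  have w4 := he.weight_eq 3
  have w5 := he.weight_eq 4
  simp [genFst, genSnd, weight_expVec] at w1 w4 w5
  fin_cases i
  · left
    simp only [ruleFst_zero, ruleSnd_zero, Fin.zero_eta, degree_expVec]
    refine lt_of_mul_lt_mul_left (a := n 0) ?_ (Nat.zero_le _)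
    nlinarith [Nat.mul_lt_mul_of_pos_right n1 h12.1,
      Nat.mul_lt_mul_of_pos_right (n1.trans n2) h13.1]
  · refine Or.inr ⟨Or.inl rfl, ?_, by simpa using h21.1⟩
    simpa [degree_expVec] using second_degree_le hn hCM he
  · left
    simpa [degree_expVec] using h3
  · left
    simp [degree_expVec]
    refine lt_of_mul_lt_mul_left (a := n 3) ?_ (Nat.zero_le _)
    nlinarith [Nat.mul_lt_mul_of_pos_right n3 h43.1,
      Nat.mul_lt_mul_of_pos_right (n1.trans (n2.trans n3)) h41.1]
  · left
    simp [degree_expVec]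
    refine lt_of_mul_lt_mul_left (a := n 2) ?_ (Nat.zero_le _)
    nlinarith [Nat.mul_lt_mul_of_pos_right n3 h24.1, Nat.mul_lt_mul_of_pos_right n2 h32.1,
      Nat.mul_lt_mul_of_pos_right (n1.trans n2) h41.1]
  · have hm0 : 0 < m0 := by rcases hm with hm | hm <;> omega
    refine Or.inr ⟨Or.inr rfl, ?_, by simpa using hm0⟩
    simpa [degree_expVec] using sixth_degree_le hn hCM he h4 hm

lemma dsGT_rule (hn : IsCurve n) (hCM : HasCMTangentCone K n) (he : GivenAsCase2b K e n)
    (h3 : e.a32 + e.a34 < e.a3) (h4 : e.a24 ≤ e.a34) (hm : IsSixthTail e m0 m1 m3) (i : Fin 6) :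
    DsGT (ruleFst e i) (ruleSnd e m0 m1 m3 i) := by
  rcases degree_rule hn hCM he h3 h4 hm i with h | ⟨-, h, h0⟩
  · exact Or.inl h
  · refine h.lt_or_eq.imp_right fun h => ⟨h, 0, fun j hj => absurd hj (Fin.not_lt_zero j), ?_⟩
    rwa [ruleFst_apply_zero]

lemma join_of_weight_eq (hn : IsCurve n) (hCM : HasCMTangentCone K n) (he : GivenAsCase2b K e n)
    (h3 : e.a32 + e.a34 < e.a3) (h4 : e.a24 ≤ e.a34) (hm : IsSixthTail e m0 m1 m3)
    (u v : Fin 4 →₀ ℕ) (h : weight n u = weight n v) :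
    Join (ReflTransGen (Step (ruleFst e) (ruleSnd e m0 m1 m3))) u v := by
  have hwf := wellFounded_swap_step hn.pos (weight_rule he h4 hm)
    (dsGT_rule hn hCM he h3 h4 hm)
  refine join_of_monomial_sub_mem_span (K := K) (a := genFst e) (b := genSnd e)
    (equivalence_join <| join_of_locally_confluent hwf <|
      locally_confluent_of_lt (join_of_overlap hn he h4 hm)) (fun i => ?_) ?_
  · have hstep : ∀ i, Step (ruleFst e) (ruleSnd e m0 m1 m3) (ruleFst e i) (ruleSnd e m0 m1 m3 i) :=
      fun i => ⟨i, 0, (add_zero _).symm, (add_zero _).symm⟩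
    -- In `f_1`, `f_3` and `f_5` the second monomial is the leading one, so the rule runs backwards.
    fin_cases i
    exacts [⟨_, .refl, .single (hstep 0)⟩, ⟨_, .single (hstep 1), .refl⟩,
      ⟨_, .refl, .single (hstep 2)⟩, ⟨_, .single (hstep 3), .refl⟩, ⟨_, .refl, .single (hstep 4)⟩]
  · rw [he.span_eq]
    exact monomial_sub_mem_toricIdeal_iff.2 h

lemma isStandardBasis_of_isSixthTail (hn : IsCurve n) (hCM : HasCMTangentCone K n)
    (he : GivenAsCase2b K e n) (h3 : e.a32 + e.a34 < e.a3) (h4 : e.a24 ≤ e.a34)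
    (hm : IsSixthTail e m0 m1 m3) :
    IsStandardBasis {f1 K e, f2 K e, f3 K e, f4 K e, f5 K e,
      X 2 ^ (e.a3 + e.a13) - X 0 ^ m0 * X 1 ^ m1 * X 3 ^ m3} (toricIdeal K n) := by
  set g : Fin 6 → MvPolynomial (Fin 4) K := ![f1 K e, f2 K e, f3 K e, f4 K e, f5 K e,
    X 2 ^ (e.a3 + e.a13) - X 0 ^ m0 * X 1 ^ m1 * X 3 ^ m3] with hg
  have hrange : ({f1 K e, f2 K e, f3 K e, f4 K e, f5 K e,
      X 2 ^ (e.a3 + e.a13) - X 0 ^ m0 * X 1 ^ m1 * X 3 ^ m3} :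
        Set (MvPolynomial (Fin 4) K)) = Set.range g := by
    simp only [hg, Matrix.range_cons, Matrix.range_empty, Set.insert_eq, Set.union_empty]
  have hgi : ∀ i, g i = monomial (ruleFst e i) 1 - monomial (ruleSnd e m0 m1 m3 i) 1 ∨
      g i = -(monomial (ruleFst e i) 1 - monomial (ruleSnd e m0 m1 m3 i) 1) := fun i => by
    rw [neg_sub]
    fin_cases i
    · right
      simp [hg, f1, monomial_expVec]
    · left
      simp [hg, f2, monomial_expVec]
    · right
      simp [hg, f3, monomial_expVec]
    · left
      simp [hg, f4, monomial_expVec]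
    · right
      simp [hg, f5, monomial_expVec]
    · left
      simp [hg, monomial_expVec]
  rw [hrange]
  have hd := dsGT_rule hn hCM he h3 h4 hm
  refine isStandardBasis_range hd (join_of_weight_eq hn hCM he h3 h4 hm) (fun i => ?_) fun i => ?_
  · have hi : monomial (ruleFst e i) (1 : K) - monomial (ruleSnd e m0 m1 m3 i) 1 ∈
        toricIdeal K n := monomial_sub_mem_toricIdeal_iff.2 (weight_rule he h4 hm i)
    rcases hgi i with h | h <;> rw [h]
    exacts [hi, neg_mem hi]
  · have hi := isLeadingMonomial_monomial_sub (K := K) (hd i)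
    rcases hgi i with h | h <;> rw [h]
    exacts [hi, hi.neg]

lemma minimallyGenerated_tangentIdeal (hn : IsCurve n) (hCM : HasCMTangentCone K n)
    (he : GivenAsCase2b K e n) (h3 : e.a32 + e.a34 < e.a3) (h4 : e.a24 ≤ e.a34)
    (hm : IsSixthTail e m0 m1 m3) {g2 g6 : MvPolynomial (Fin 4) K}
    (hg2 : binomialLeastForm K (expVec 0 e.a2 0 0) (expVec e.a21 0 0 e.a24) = g2)
    (hg6 : binomialLeastForm K (expVec 0 0 (e.a3 + e.a13) 0) (expVec m0 m1 0 m3) = g6) :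
    MinimallyGenerated (tangentIdeal (toricIdeal K n))
      ![X 1 ^ e.a12 * X 2 ^ e.a13, g2, X 1 ^ e.a32 * X 3 ^ e.a34, X 3 ^ e.a4,
        X 2 ^ e.a13 * X 3 ^ e.a24, g6] := by
  have hd := dsGT_rule hn hCM he h3 h4 hm
  have hdeg := degree_rule hn hCM he h3 h4 hm
  have hvec : ![X 1 ^ e.a12 * X 2 ^ e.a13, g2, X 1 ^ e.a32 * X 3 ^ e.a34, X 3 ^ e.a4,
      X 2 ^ e.a13 * X 3 ^ e.a24, g6] =
      fun i => binomialLeastForm K (ruleFst e i) (ruleSnd e m0 m1 m3 i) := by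
    have hlt : ∀ i, i ≠ 1 → i ≠ 5 → binomialLeastForm K (ruleFst e i) (ruleSnd e m0 m1 m3 i) =
        monomial (ruleFst e i) 1 := fun i h1 h5 =>
      if_pos ((hdeg i).resolve_right fun h => h.1.elim h1 h5)
    funext i
    fin_cases i
    · simpa [monomial_expVec] using (hlt 0 (by decide) (by decide)).symm
    · exact hg2.symm
    · simpa [monomial_expVec] using (hlt 2 (by decide) (by decide)).symm
    · simpa [monomial_expVec] using (hlt 3 (by decide) (by decide)).symm
    · simpa [monomial_expVec] using (hlt 4 (by decide) (by decide)).symm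
    · exact hg6.symm
  rw [hvec]
  refine ⟨span_binomialLeastForm (weight_rule he h4 hm) hd (join_of_weight_eq hn hCM he h3 h4 hm),
    binomialLeastForm_notMem_span (fun i j hij => ?_) ruleFst_apply_zero (fun i hi => ?_)
      fun i => (hdeg i).elim le_of_lt fun h => h.2.1⟩
  · obtain ⟨h12, h13, h21, h24, h32, h34, h41, h43, -⟩ := id he
    fin_cases i <;> fin_cases j <;> first | rfl | (simp [expVec_le_iff] at hij; omega)
  · rcases hdeg i with h | h
    exacts [absurd hi h.ne, h.2.2.ne']

lemma binomialLeastForm_expVec_of_lt {a b c d a' b' c' d' : ℕ}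
    (h : a + b + c + d < a' + b' + c' + d') :
    binomialLeastForm K (expVec a b c d) (expVec a' b' c' d') =
      X 0 ^ a * X 1 ^ b * X 2 ^ c * X 3 ^ d := by
  rw [binomialLeastForm, degree_expVec, degree_expVec, if_pos h, monomial_expVec]

lemma binomialLeastForm_expVec_of_eq {a b c d a' b' c' d' : ℕ}
    (h : a + b + c + d = a' + b' + c' + d') :
    binomialLeastForm K (expVec a b c d) (expVec a' b' c' d') =
      X 0 ^ a * X 1 ^ b * X 2 ^ c * X 3 ^ d - X 0 ^ a' * X 1 ^ b' * X 2 ^ c' * X 3 ^ d' := by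
  rw [binomialLeastForm, degree_expVec, degree_expVec, if_neg h.not_lt, monomial_expVec,
    monomial_expVec]

lemma tangentCone_of_isSixthTail (hn : IsCurve n) (hCM : HasCMTangentCone K n)
    (he : GivenAsCase2b K e n) (h3 : e.a32 + e.a34 < e.a3) (h4 : e.a24 ≤ e.a34)
    (hm : IsSixthTail e m0 m1 m3) :
    (e.a2 < e.a21 + e.a24 → e.a3 + e.a13 < m0 + m1 + m3 →
      MinimallyGenerated (tangentIdeal (toricIdeal K n))
        ![X 1 ^ e.a12 * X 2 ^ e.a13, X 1 ^ e.a2, X 1 ^ e.a32 * X 3 ^ e.a34,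
          X 3 ^ e.a4, X 2 ^ e.a13 * X 3 ^ e.a24, X 2 ^ (e.a3 + e.a13)]) ∧
    (e.a2 < e.a21 + e.a24 → e.a3 + e.a13 = m0 + m1 + m3 →
      MinimallyGenerated (tangentIdeal (toricIdeal K n))
        ![X 1 ^ e.a12 * X 2 ^ e.a13, X 1 ^ e.a2, X 1 ^ e.a32 * X 3 ^ e.a34,
          X 3 ^ e.a4, X 2 ^ e.a13 * X 3 ^ e.a24,
          X 2 ^ (e.a3 + e.a13) - X 0 ^ m0 * X 1 ^ m1 * X 3 ^ m3]) ∧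
    (e.a2 = e.a21 + e.a24 → e.a3 + e.a13 < m0 + m1 + m3 →
      MinimallyGenerated (tangentIdeal (toricIdeal K n))
        ![X 1 ^ e.a12 * X 2 ^ e.a13, X 1 ^ e.a2 - X 0 ^ e.a21 * X 3 ^ e.a24,
          X 1 ^ e.a32 * X 3 ^ e.a34, X 3 ^ e.a4, X 2 ^ e.a13 * X 3 ^ e.a24,
          X 2 ^ (e.a3 + e.a13)]) ∧
    (e.a2 = e.a21 + e.a24 → e.a3 + e.a13 = m0 + m1 + m3 →
      MinimallyGenerated (tangentIdeal (toricIdeal K n))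
        ![X 1 ^ e.a12 * X 2 ^ e.a13, X 1 ^ e.a2 - X 0 ^ e.a21 * X 3 ^ e.a24,
          X 1 ^ e.a32 * X 3 ^ e.a34, X 3 ^ e.a4, X 2 ^ e.a13 * X 3 ^ e.a24,
          X 2 ^ (e.a3 + e.a13) - X 0 ^ m0 * X 1 ^ m1 * X 3 ^ m3]) := by
  refine ⟨fun h2 h6 => ?_, fun h2 h6 => ?_, fun h2 h6 => ?_, fun h2 h6 => ?_⟩ <;>
    refine minimallyGenerated_tangentIdeal hn hCM he h3 h4 hm ?_ ?_ <;>
    first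
    | rw [binomialLeastForm_expVec_of_lt (by omega)]
      simp
    | rw [binomialLeastForm_expVec_of_eq (by omega)]
      simp

end Rules

end MonomialCurve

end

open MonomialCurve MvPolynomial in
theorem theorem2p20 (K : Type*) [Field K] (n : Fin 4 → ℕ) (hn : IsCurve n)
    (hCM : HasCMTangentCone K n) (e : Exponents) (he : GivenAsCase2b K e n)
    (h3 : e.a32 + e.a34 < e.a3) (h4 : e.a24 ≤ e.a34) :
    (e.a32 < e.a12 →
        IsStandardBasis {f1 K e, f2 K e, f3 K e, f4 K e, f5 K e, f6 K e} (toricIdeal K n) ∧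
        (e.a2 < e.a21 + e.a24 → e.a3 + e.a13 < e.a41 + 2 * e.a32 + (e.a34 - e.a24) →
          MinimallyGenerated (tangentIdeal (toricIdeal K n))
            ![X 1 ^ e.a12 * X 2 ^ e.a13, X 1 ^ e.a2, X 1 ^ e.a32 * X 3 ^ e.a34,
              X 3 ^ e.a4, X 2 ^ e.a13 * X 3 ^ e.a24, X 2 ^ (e.a3 + e.a13)]) ∧
        (e.a2 < e.a21 + e.a24 → e.a3 + e.a13 = e.a41 + 2 * e.a32 + (e.a34 - e.a24) →
          MinimallyGenerated (tangentIdeal (toricIdeal K n))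
            ![X 1 ^ e.a12 * X 2 ^ e.a13, X 1 ^ e.a2, X 1 ^ e.a32 * X 3 ^ e.a34,
              X 3 ^ e.a4, X 2 ^ e.a13 * X 3 ^ e.a24, X 2 ^ (e.a3 + e.a13) - X 0 ^ e.a41 * X 1 ^ (2 * e.a32) * X 3 ^ (e.a34 - e.a24)]) ∧
        (e.a2 = e.a21 + e.a24 → e.a3 + e.a13 < e.a41 + 2 * e.a32 + (e.a34 - e.a24) →
          MinimallyGenerated (tangentIdeal (toricIdeal K n))
            ![X 1 ^ e.a12 * X 2 ^ e.a13, X 1 ^ e.a2 - X 0 ^ e.a21 * X 3 ^ e.a24, X 1 ^ e.a32 * X 3 ^ e.a34,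
              X 3 ^ e.a4, X 2 ^ e.a13 * X 3 ^ e.a24, X 2 ^ (e.a3 + e.a13)]) ∧
        (e.a2 = e.a21 + e.a24 → e.a3 + e.a13 = e.a41 + 2 * e.a32 + (e.a34 - e.a24) →
          MinimallyGenerated (tangentIdeal (toricIdeal K n))
            ![X 1 ^ e.a12 * X 2 ^ e.a13, X 1 ^ e.a2 - X 0 ^ e.a21 * X 3 ^ e.a24, X 1 ^ e.a32 * X 3 ^ e.a34,
              X 3 ^ e.a4, X 2 ^ e.a13 * X 3 ^ e.a24, X 2 ^ (e.a3 + e.a13) - X 0 ^ e.a41 * X 1 ^ (2 * e.a32) * X 3 ^ (e.a34 - e.a24)])) ∧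
    (e.a12 ≤ e.a32 →
        IsStandardBasis {f1 K e, f2 K e, f3 K e, f4 K e, f5 K e, f6Alt K e} (toricIdeal K n) ∧
        (e.a2 < e.a21 + e.a24 → e.a3 + e.a13 < e.a1 + (e.a32 - e.a12) + e.a34 →
          MinimallyGenerated (tangentIdeal (toricIdeal K n))
            ![X 1 ^ e.a12 * X 2 ^ e.a13, X 1 ^ e.a2, X 1 ^ e.a32 * X 3 ^ e.a34,
              X 3 ^ e.a4, X 2 ^ e.a13 * X 3 ^ e.a24, X 2 ^ (e.a3 + e.a13)]) ∧
        (e.a2 < e.a21 + e.a24 → e.a3 + e.a13 = e.a1 + (e.a32 - e.a12) + e.a34 →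
          MinimallyGenerated (tangentIdeal (toricIdeal K n))
            ![X 1 ^ e.a12 * X 2 ^ e.a13, X 1 ^ e.a2, X 1 ^ e.a32 * X 3 ^ e.a34,
              X 3 ^ e.a4, X 2 ^ e.a13 * X 3 ^ e.a24, X 2 ^ (e.a3 + e.a13) - X 0 ^ e.a1 * X 1 ^ (e.a32 - e.a12) * X 3 ^ e.a34]) ∧
        (e.a2 = e.a21 + e.a24 → e.a3 + e.a13 < e.a1 + (e.a32 - e.a12) + e.a34 →
          MinimallyGenerated (tangentIdeal (toricIdeal K n))
            ![X 1 ^ e.a12 * X 2 ^ e.a13, X 1 ^ e.a2 - X 0 ^ e.a21 * X 3 ^ e.a24, X 1 ^ e.a32 * X 3 ^ e.a34,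
              X 3 ^ e.a4, X 2 ^ e.a13 * X 3 ^ e.a24, X 2 ^ (e.a3 + e.a13)]) ∧
        (e.a2 = e.a21 + e.a24 → e.a3 + e.a13 = e.a1 + (e.a32 - e.a12) + e.a34 →
          MinimallyGenerated (tangentIdeal (toricIdeal K n))
            ![X 1 ^ e.a12 * X 2 ^ e.a13, X 1 ^ e.a2 - X 0 ^ e.a21 * X 3 ^ e.a24, X 1 ^ e.a32 * X 3 ^ e.a34,
              X 3 ^ e.a4, X 2 ^ e.a13 * X 3 ^ e.a24, X 2 ^ (e.a3 + e.a13) - X 0 ^ e.a1 * X 1 ^ (e.a32 - e.a12) * X 3 ^ e.a34])) := by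
  refine ⟨fun h => ?_, fun h => ?_⟩
  · have hm : IsSixthTail e e.a41 (2 * e.a32) (e.a34 - e.a24) := Or.inl ⟨h, rfl, rfl, rfl⟩
    exact ⟨isStandardBasis_of_isSixthTail hn hCM he h3 h4 hm,
      tangentCone_of_isSixthTail hn hCM he h3 h4 hm⟩
  · have hm : IsSixthTail e e.a1 (e.a32 - e.a12) e.a34 := Or.inr ⟨h, rfl, rfl, rfl⟩
    exact ⟨isStandardBasis_of_isSixthTail hn hCM he h3 h4 hm,
      tangentCone_of_isSixthTail hn hCM he h3 h4 hm⟩
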